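/- Let $d\ge 1$, let $D\subset\mathbb R^d$ be a bounded open set (for example a bounded polygonal domain), and let $V=H^1_0(D)$ with norm $\|v\|_V=\|\nabla v\|_{L^2(D)}$. Let $\{\phi_j\}_{j\ge1}$ be real-valued measurable functions on $D$, let $\alpha\in\mathbb N=\{1,2,\dots\}$, and let $\{b_j\}_{j\ge1}$ satisfy $0<b_j\le1$ for all $j$, $\{b_j\}\in\ell^{p^*}(\mathbb N)$ for some $p^*\in(0,1]$, and $$\kappa:=\Big\|\sum_{j\ge1}\frac{|\phi_j|}{b_j}\Big\|_{L^\infty(D)}<\frac{\ln 2}{\alpha}.$$ Let $f,G\in V^*$ and let $\mathfrak u\subset\mathbb N$ be finite. For finite $\mathfrak v\subset\mathbb N$ and real $y_j$ $(j\in\mathfrak v)$ let $u(\cdot,y_{\mathfrak v})\in V$ be the weak solution of the lognormal diffusion problem truncated to $\mathfrak v$, $$\int_D \exp\Big(\sum_{j\in\mathfrak v}y_j\phi_j(x)\Big)\,\nabla u(x,y_{\mathfrak v})\cdot\nabla w(x)\,dx=f(w)\qquad\text{for all } w\in V,$$ and put $u_{\mathfrak u}(\cdot,y_{\mathfrak u})=\sum_{\mathfrak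 v\subseteq\mathfrak u}(-1)^{|\mathfrak u|-|\mathfrak v|}u(\cdot,y_{\mathfrak v})$. For a finite-dimensional subspace $V^h\subset V$ let $u^h(\cdot,y_{\mathfrak v})\in V^h$ and $u^h_{\mathfrak u}$ be defined in the same way with $V$ replaced by $V^h$ (Galerkin/finite element approximation). For a Hilbert space $E$ (here $E=V$ or $E=\mathbb R$) and $\rho(y)=e^{-y^2/2}/\sqrt{2\pi}$, let $H_{\alpha,0,\rho,|\mathfrak u|}(\mathbb R^{|\mathfrak u|};E)$ be the anchored Gaussian Sobolev space of functions $F:\mathbb R^{\mathfrak u}\to E$ that vanish whenever some $y_j=0$, are integrable with respect to the standard Gaussian measure, have mixed derivatives $\partial^\tau F$ for all $\tau\in\{0,\dots,\alpha\}^{\mathfrak u}$ (locally absolutely continuous in each direction in which the order is less than $\alpha$), and have finite norm $$\|F\|^2=\sum_{\tau\in\{1,\dots,\alpha\}^{\mathfrak u}}\int_{\mathbb R^{|\mathfrak v|}}\|\partial^{\tau}F(y_{\mathfrak v},0)\|_E^2\prod_{j\in\mathfrak v}\rho(y_j)\,dy_{\mathfrak v},\qquad \mathfrak v=\{j\in\mathfrak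 u:\tau_j=\alpha\}.$$ Then all the solutions above exist and are unique, $u_{\mathfrak u}\in H_{\alpha,0,\rho,|\mathfrak u|}(\mathbb R^{|\mathfrak u|};V)$ and $G(u_{\mathfrak u})\in H_{\alpha,0,\rho,|\mathfrak u|}(\mathbb R^{|\mathfrak u|};\mathbb R)$. Moreover, for every $\delta\in(0,1)$ with $\kappa<\delta\ln2/\alpha$, $$\|u_{\mathfrak u}\|\le C'\,2^{|\mathfrak u|/2}\Big(\prod_{j\in\mathfrak u}b_j\Big)\|f\|_{V^*},\qquad \|G(u_{\mathfrak u})\|\le C'\,2^{|\mathfrak u|/2}\Big(\prod_{j\in\mathfrak u}b_j\Big)\|G\|_{V^*}\|f\|_{V^*},$$ where $$C'=\Big(\sum_{k\ge0}\delta^k\Big)^{1/2}\exp\Big(\sum_{j\ge1}\Big[(\kappa b_j)^2+\frac{2\kappa b_j}{\sqrt{2\pi}}\Big]\Big).$$ For every finite-dimensional subspace $V^h\subset V$, also $u^h_{\mathfrak u}$ and $G(u^h_{\mathfrak u})$ belong to these spaces and satisfy the same two bounds, with the same constants (hence uniformly in $V^h$). -/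

import Mathlib

open MeasureTheory TopologicalSpace Set
open scoped ENNReal NNReal ContDiff Distributions RealInnerProductSpace

noncomputable section

namespace LognormalPDE

/-! ### The space `V = H¹₀(Ω)` with the norm `‖∇v‖_{L²(Ω)}` -/

section SobolevSpace

variable {d : ℕ} (Ω : Opens (EuclideanSpace ℝ (Fin d)))

/-- `L²(Ω)`. -/
abbrev L2 : Type := Lp ℝ 2 (volume.restrict (Ω : Set (EuclideanSpace ℝ (Fin d))))

/-- `L²(Ω; ℝᵈ)`. -/
abbrev L2Vec : Type :=
  Lp (EuclideanSpace ℝ (Fin d)) 2 (volume.restrict (Ω : Set (EuclideanSpace ℝ (Fin d))))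

theorem gradient_add_test (φ ψ : 𝓓(Ω, ℝ)) (x : EuclideanSpace ℝ (Fin d)) :
    gradient (⇑(φ + ψ)) x = gradient (⇑φ) x + gradient (⇑ψ) x := by
  have h1 : DifferentiableAt ℝ (⇑φ) x := (φ.contDiff.differentiable (by simp)) x
  have h2 : DifferentiableAt ℝ (⇑ψ) x := (ψ.contDiff.differentiable (by simp)) x
  have : (⇑(φ + ψ) : EuclideanSpace ℝ (Fin d) → ℝ) = ⇑φ + ⇑ψ := rfl
  simp only [gradient, this, fderiv_add h1 h2, map_add]

theorem gradient_smul_test (c : ℝ) (φ : 𝓓(Ω, ℝ)) (x : EuclideanSpace ℝ (Fin d)) :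
    gradient (⇑(c • φ)) x = c • gradient (⇑φ) x := by
  have h1 : DifferentiableAt ℝ (⇑φ) x := (φ.contDiff.differentiable (by simp)) x
  have : (⇑(c • φ) : EuclideanSpace ℝ (Fin d) → ℝ) = c • ⇑φ := rfl
  simp only [gradient, this, fderiv_const_smul h1, map_smul]

/-- The pairs `(φ, ∇φ)` in `L²(Ω) × L²(Ω; ℝᵈ)`, for `φ ∈ C_c^∞(Ω)`. -/
def testPairs : Submodule ℝ (L2 Ω × L2Vec Ω) where
  carrier := {p | ∃ φ : 𝓓(Ω, ℝ),
    (p.1 =ᵐ[volume.restrict (Ω : Set (EuclideanSpace ℝ (Fin d)))] ⇑φ) ∧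
    (p.2 =ᵐ[volume.restrict (Ω : Set (EuclideanSpace ℝ (Fin d)))] gradient (⇑φ))}
  zero_mem' := by
    refine ⟨0, ?_, ?_⟩
    · filter_upwards [Lp.coeFn_zero ℝ 2 (volume.restrict (Ω : Set (EuclideanSpace ℝ (Fin d))))]
        with x hx
      exact hx
    · filter_upwards [Lp.coeFn_zero (EuclideanSpace ℝ (Fin d)) 2
        (volume.restrict (Ω : Set (EuclideanSpace ℝ (Fin d))))] with x hx
      have h0 : gradient (⇑(0 : 𝓓(Ω, ℝ))) x = 0 := by
        simpa using gradient_smul_test Ω 0 0 x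
      rw [h0]
      exact hx
  add_mem' := by
    rintro p q ⟨φ, hφ1, hφ2⟩ ⟨ψ, hψ1, hψ2⟩
    refine ⟨φ + ψ, ?_, ?_⟩
    · filter_upwards [Lp.coeFn_add p.1 q.1, hφ1, hψ1] with x hx h1 h2
      simp only [Prod.fst_add, hx, Pi.add_apply, h1, h2]
      rfl
    · filter_upwards [Lp.coeFn_add p.2 q.2, hφ2, hψ2] with x hx h1 h2
      simp only [Prod.snd_add, hx, Pi.add_apply, h1, h2, gradient_add_test]
  smul_mem' := by
    rintro c p ⟨φ, hφ1, hφ2⟩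
    refine ⟨c • φ, ?_, ?_⟩
    · filter_upwards [Lp.coeFn_smul c p.1, hφ1] with x hx h1
      simp only [Prod.smul_fst, hx, Pi.smul_apply, h1]
      rfl
    · filter_upwards [Lp.coeFn_smul c p.2, hφ2] with x hx h1
      simp only [Prod.smul_snd, hx, Pi.smul_apply, h1, gradient_smul_test]

/-- The closure of `C_c^∞(Ω)` in `H¹(Ω)`; an element is a function together with its weak
gradient. -/
def H10Graph : Submodule ℝ (L2 Ω × L2Vec Ω) := (testPairs Ω).topologicalClosure

/-- The space `V = H¹₀(Ω)`. As a vector space it is the closure of `C_c^∞(Ω)` in `H¹(Ω)`; it gets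
its own norm `‖v‖_V = ‖∇v‖_{L²(Ω)}` below. -/
def H10 : Type := H10Graph Ω

instance : AddCommGroup (H10 Ω) := inferInstanceAs (AddCommGroup (H10Graph Ω))

instance : Module ℝ (H10 Ω) := inferInstanceAs (Module ℝ (H10Graph Ω))

/-- The underlying function in `L²(Ω)` of `v ∈ H¹₀(Ω)`. -/
def toL2 : H10 Ω →ₗ[ℝ] L2 Ω := (LinearMap.fst ℝ _ _).comp (H10Graph Ω).subtype

/-- The weak gradient of `v ∈ H¹₀(Ω)`. -/
def grad : H10 Ω →ₗ[ℝ] L2Vec Ω := (LinearMap.snd ℝ _ _).comp (H10Graph Ω).subtype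

end SobolevSpace

section Poincare

variable {d : ℕ} [NeZero d] (Ω : Opens (EuclideanSpace ℝ (Fin d)))

theorem poincare_test (R : ℝ) (hR : ∀ x ∈ (Ω : Set (EuclideanSpace ℝ (Fin d))), ‖x‖ ≤ R)
    (φ : 𝓓(Ω, ℝ)) :
    ∫ x in (Ω : Set (EuclideanSpace ℝ (Fin d))), ‖φ x‖ ^ 2
      ≤ (2 * R) ^ 2 *
        ∫ x in (Ω : Set (EuclideanSpace ℝ (Fin d))), ‖gradient (⇑φ) x‖ ^ 2 := by
  have hd1 : ∀ x, DifferentiableAt ℝ (⇑φ) x := fun x => (φ.contDiff.differentiable (by simp)) x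
  have hcφ : Continuous (⇑φ) := φ.continuous
  have hcf : Continuous (fderiv ℝ (⇑φ)) := φ.contDiff.continuous_fderiv (by simp)
  have hcg : Continuous (gradient (⇑φ)) :=
    (InnerProductSpace.toDual ℝ (EuclideanSpace ℝ (Fin d))).symm.continuous.comp hcf
  have hφ0 : ∀ x, x ∉ (Ω : Set (EuclideanSpace ℝ (Fin d))) → φ x = 0 := fun x hx =>
    image_eq_zero_of_notMem_tsupport (fun h => hx (φ.tsupport_subset h))
  have hf0 : ∀ x, x ∉ tsupport (⇑φ) → fderiv ℝ (⇑φ) x = 0 := fun x hx =>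
    Function.notMem_support.mp (fun h => hx (support_fderiv_subset ℝ h))
  have hg0 : ∀ x, x ∉ tsupport (⇑φ) → gradient (⇑φ) x = 0 := fun x hx => by
    simp [gradient, hf0 x hx]
  have hK : HasCompactSupport (⇑φ) := φ.hasCompactSupport
  rw [setIntegral_eq_integral_of_forall_compl_eq_zero (fun x hx => by simp [hφ0 x hx]),
    setIntegral_eq_integral_of_forall_compl_eq_zero
      (fun x hx => by simp [hg0 x (fun h => hx (φ.tsupport_subset h))])]
  have hi1 : Integrable (fun x => ‖φ x‖ ^ 2) :=
    Continuous.integrable_of_hasCompactSupport (by fun_prop)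
      (HasCompactSupport.intro hK (fun x hx => by simp [image_eq_zero_of_notMem_tsupport hx]))
  have hi2 : Integrable (fun x => ‖gradient (⇑φ) x‖ ^ 2) :=
    Continuous.integrable_of_hasCompactSupport (by fun_prop)
      (HasCompactSupport.intro hK (fun x hx => by simp [hg0 x hx]))
  set e : EuclideanSpace ℝ (Fin d) := EuclideanSpace.single 0 1 with he
  have hfd : ∀ x, fderiv ℝ (fun x => φ x ^ 2) x e = 2 * φ x * fderiv ℝ (⇑φ) x e := fun x => by
    have := ((hd1 x).hasFDerivAt.pow 2).fderiv
    simp only [this]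
    simp
  set g : EuclideanSpace ℝ (Fin d) →L[ℝ] ℝ := EuclideanSpace.proj 0 with hg
  have hge : ∀ x, fderiv ℝ (⇑g) x e = 1 := fun x => by
    rw [g.fderiv]
    simp [hg, he]
  have hcfe : Continuous (fun x => fderiv ℝ (⇑φ) x e) := hcf.clm_apply continuous_const
  have hcgc : Continuous (⇑g) := g.continuous
  have hI : Integrable (fun x => 2 * φ x * fderiv ℝ (⇑φ) x e * g x) :=
    Continuous.integrable_of_hasCompactSupport (by fun_prop)
      (HasCompactSupport.intro hK (fun x hx => by simp [image_eq_zero_of_notMem_tsupport hx]))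
  have key := integral_mul_fderiv_eq_neg_fderiv_mul_of_integrable (μ := volume)
    (f := fun x => φ x ^ 2) (g := ⇑g) (v := e) (by simpa only [hfd] using hI)
    (Continuous.integrable_of_hasCompactSupport (by simp only [hge]; fun_prop)
      (HasCompactSupport.intro hK (fun x hx => by
        simp [image_eq_zero_of_notMem_tsupport hx])))
    (Continuous.integrable_of_hasCompactSupport (by fun_prop)
      (HasCompactSupport.intro hK (fun x hx => by
        simp [image_eq_zero_of_notMem_tsupport hx])))
    (fun x _ => (hd1 x).pow 2) (fun x _ => g.differentiableAt)
  simp only [hge, hfd, mul_one] at key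
  rw [← integral_neg] at key
  have hle : ∫ x, ‖φ x‖ ^ 2 ≤
      ∫ x, ((1 / 2) * ‖φ x‖ ^ 2 + 2 * R ^ 2 * ‖gradient (⇑φ) x‖ ^ 2) := by
    have h1 : ∫ x, ‖φ x‖ ^ 2 = ∫ x, φ x ^ 2 := by simp
    rw [h1, key]
    refine integral_mono hI.neg ((hi1.const_mul _).add (hi2.const_mul _)) (fun x => ?_)
    by_cases hx : x ∈ (Ω : Set (EuclideanSpace ℝ (Fin d)))
    · have hgx : |g x| ≤ R := by
        refine le_trans ?_ (hR x hx)
        simpa [hg] using PiLp.norm_apply_le x 0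
      have hfx : |fderiv ℝ (⇑φ) x e| ≤ ‖gradient (⇑φ) x‖ := by
        have h2 : ‖gradient (⇑φ) x‖ = ‖fderiv ℝ (⇑φ) x‖ := by simp [gradient]
        have h3 : ‖e‖ = 1 := by simp [he]
        have h4 := (fderiv ℝ (⇑φ) x).le_opNorm e
        rw [h3, mul_one, Real.norm_eq_abs] at h4
        rw [h2]
        exact h4
      have h5 : |2 * φ x * fderiv ℝ (⇑φ) x e * g x| ≤ 2 * ‖φ x‖ * (‖gradient (⇑φ) x‖ * R) := by
        rw [mul_assoc, abs_mul, abs_mul, abs_mul, abs_two, Real.norm_eq_abs]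
        gcongr
      have h6 := (abs_le.mp h5).1
      nlinarith [sq_nonneg (‖φ x‖ - 2 * (‖gradient (⇑φ) x‖ * R))]
    · simp only [hφ0 x hx]
      simp only [mul_zero, zero_mul, neg_zero, norm_zero]
      positivity
  rw [integral_add (hi1.const_mul _) (hi2.const_mul _), integral_const_mul,
    integral_const_mul] at hle
  nlinarith

theorem poincare_graph (R : ℝ) (hR0 : 0 ≤ R)
    (hR : ∀ x ∈ (Ω : Set (EuclideanSpace ℝ (Fin d))), ‖x‖ ≤ R) (v : H10 Ω) :
    ‖toL2 Ω v‖ ≤ 2 * R * ‖grad Ω v‖ := by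
  have hcl : IsClosed {p : L2 Ω × L2Vec Ω | ‖p.1‖ ≤ 2 * R * ‖p.2‖} :=
    isClosed_le (by fun_prop) (by fun_prop)
  have hsub : (testPairs Ω : Set (L2 Ω × L2Vec Ω)) ⊆ {p | ‖p.1‖ ≤ 2 * R * ‖p.2‖} := by
    rintro p ⟨φ, h1, h2⟩
    have e1 : ‖p.1‖ ^ 2 = ∫ x in (Ω : Set (EuclideanSpace ℝ (Fin d))), ‖φ x‖ ^ 2 := by
      rw [← real_inner_self_eq_norm_sq, L2.inner_def]
      refine integral_congr_ae ?_
      filter_upwards [h1] with x hx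
      rw [real_inner_self_eq_norm_sq, hx]
    have e2 : ‖p.2‖ ^ 2 =
        ∫ x in (Ω : Set (EuclideanSpace ℝ (Fin d))), ‖gradient (⇑φ) x‖ ^ 2 := by
      rw [← real_inner_self_eq_norm_sq, L2.inner_def]
      refine integral_congr_ae ?_
      filter_upwards [h2] with x hx
      rw [real_inner_self_eq_norm_sq, hx]
    have h3 := poincare_test Ω R hR φ
    rw [← e1, ← e2, ← mul_pow] at h3
    exact le_of_sq_le_sq h3 (by positivity)
  have hv : (v : H10Graph Ω).1 ∈ {p : L2 Ω × L2Vec Ω | ‖p.1‖ ≤ 2 * R * ‖p.2‖} :=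
    closure_minimal hsub hcl (v : H10Graph Ω).2
  exact hv

variable [hΩ : Fact (Bornology.IsBounded (Ω : Set (EuclideanSpace ℝ (Fin d))))]

theorem exists_poincare : ∃ C : ℝ, 0 ≤ C ∧ ∀ v : H10 Ω, ‖toL2 Ω v‖ ≤ C * ‖grad Ω v‖ := by
  obtain ⟨R, hR⟩ := hΩ.out.exists_norm_le
  refine ⟨2 * max R 0, by positivity, fun v => ?_⟩
  exact poincare_graph Ω (max R 0) (le_max_right _ _)
    (fun x hx => (hR x hx).trans (le_max_left _ _)) v

theorem grad_injective (v : H10 Ω) (hv : grad Ω v = 0) : v = 0 := by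
  obtain ⟨C, -, hC⟩ := exists_poincare Ω
  have h := hC v
  rw [hv, norm_zero, mul_zero] at h
  have h' : toL2 Ω v = 0 := norm_le_zero_iff.mp h
  exact Subtype.ext (Prod.ext h' hv)

/-- The inner product `⟪v, w⟫ = ∫_Ω ∇v · ∇w` on `H¹₀(Ω)`, for bounded `Ω`. -/
@[reducible]
def innerCore : InnerProductSpace.Core ℝ (H10 Ω) where
  inner v w := ⟪grad Ω v, grad Ω w⟫
  conj_inner_symm v w := by simp [real_inner_comm]
  re_inner_nonneg v := by simp
  add_left u v w := by simp [inner_add_left]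
  smul_left u v r := by simp [inner_smul_left]
  definite v hv := grad_injective Ω v (inner_self_eq_zero.mp hv)

instance : NormedAddCommGroup (H10 Ω) := (innerCore Ω).toNormedAddCommGroup

instance : InnerProductSpace ℝ (H10 Ω) := InnerProductSpace.ofCore (innerCore Ω).toCore

theorem norm_H10 (v : H10 Ω) : ‖v‖ = ‖grad Ω v‖ := by
  rw [norm_eq_sqrt_real_inner (grad Ω v)]
  rfl

instance : CompleteSpace (H10 Ω) := by
  obtain ⟨C, hC0, hC⟩ := exists_poincare Ω
  have hG : CompleteSpace (H10Graph Ω) :=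
    (Submodule.isClosed_topologicalClosure (testPairs Ω)).completeSpace_coe
  let e : H10 Ω ≃ₗ[ℝ] H10Graph Ω := LinearEquiv.refl ℝ (H10Graph Ω)
  let E : H10 Ω ≃L[ℝ] H10Graph Ω := e.toContinuousLinearEquivOfBounds (max C 1) 1
    (fun v => by
      have h1 : ‖e v‖ = max ‖toL2 Ω v‖ ‖grad Ω v‖ := rfl
      rw [h1, norm_H10]
      refine max_le ((hC v).trans ?_) ?_
      · exact mul_le_mul_of_nonneg_right (le_max_left _ _) (norm_nonneg _)
      · exact le_mul_of_one_le_left (norm_nonneg _) (le_max_right _ _))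
    (fun v => by
      rw [norm_H10, one_mul]
      exact le_max_right ‖v.1.1‖ ‖v.1.2‖)
  exact (completeSpace_congr (e := E.toEquiv) E.isUniformEmbedding).mpr hG

end Poincare

/-! ### The anchored Gaussian Sobolev space `H_{α,0,ρ}(ℝ^ι; E)` -/

section AnchoredSpace

variable {ι : Type*}

/-- The vector with coordinates `z i` where `p i` holds and `w i` elsewhere. -/
def glue (p : ι → Prop) [DecidablePred p] (z : {i // p i} → ℝ) (w : ι → ℝ) : ι → ℝ :=
  fun i => if h : p i then z ⟨i, h⟩ else w i

/-- The product standard Gaussian measure, with density `∏ ρ(y_i)`, on `ℝ^κ`. -/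
def gaussian (κ : Type*) [Fintype κ] : Measure (κ → ℝ) :=
  Measure.pi fun _ : κ => ProbabilityTheory.gaussianReal 0 1

variable [Fintype ι] [DecidableEq ι] {E : Type*} [NormedAddCommGroup E] [NormedSpace ℝ E]

/-- `D τ`, for multi-indices `τ ≤ (α, …, α)`, are the mixed partial derivatives `∂^τ F`:
in every coordinate direction the derivatives of order less than `α` are locally absolutely
continuous (they are recovered by integrating the next one).
A derivative that is of top order `α` in the coordinates `v = {i : τ i = α}` need only be defined
for almost every value `z` of these coordinates; `w` supplies the remaining coordinates. -/
structure IsMixedDerivFamily (α : ℕ) (F : (ι → ℝ) → E) (D : (ι → ℕ) → (ι → ℝ) → E) : Prop where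
  zero : D 0 = F
  measurable : ∀ τ : ι → ℕ, (∀ i, τ i ≤ α) → ∀ w : ι → ℝ,
    AEStronglyMeasurable (fun z : {i // τ i = α} → ℝ => D τ (glue (fun i => τ i = α) z w)) volume
  ftc : ∀ τ : ι → ℕ, (∀ i, τ i ≤ α) → ∀ j, τ j < α →
    ∀ᵐ z : {i // τ i = α} → ℝ, ∀ (w : ι → ℝ) (t : ℝ),
      IntervalIntegrable (fun r => D (Function.update τ j (τ j + 1))
        (Function.update (glue (fun i => τ i = α) z w) j r)) volume 0 t ∧
      D τ (Function.update (glue (fun i => τ i = α) z w) j t) =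
        D τ (Function.update (glue (fun i => τ i = α) z w) j 0) +
          ∫ r in (0 : ℝ)..t, D (Function.update τ j (τ j + 1))
            (Function.update (glue (fun i => τ i = α) z w) j r)

/-- `(∑_{τ ∈ {1:α}^ι} ∫_{ℝ^v} ‖D τ (z, 0)‖² ρ_v(z) dz)^{1/2}` with `v = {i : τ i = α}`. -/
def normOfFamily (α : ℕ) (D : (ι → ℕ) → (ι → ℝ) → E) : ℝ≥0∞ :=
  (∑ τ ∈ Fintype.piFinset fun _ : ι => Finset.Icc 1 α,
    ∫⁻ z : {i // τ i = α} → ℝ, ‖D τ (glue (fun i => τ i = α) z 0)‖ₑ ^ 2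
      ∂(gaussian {i // τ i = α})) ^ (1 / 2 : ℝ)

/-- The norm `‖F‖_{H_{α,0,ρ}(ℝ^ι; E)}`. The family of mixed derivatives is unique up to the null
sets that the norm ignores, so the infimum only picks it; it is `∞` if there is no such family. -/
def anchoredNorm (α : ℕ) (F : (ι → ℝ) → E) : ℝ≥0∞ :=
  ⨅ (D : (ι → ℕ) → (ι → ℝ) → E) (_ : IsMixedDerivFamily α F D), normOfFamily α D

/-- Membership in `H_{α,0,ρ}(ℝ^ι; E)`. -/
structure MemAnchored (α : ℕ) (F : (ι → ℝ) → E) : Prop where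
  anchored : ∀ y : ι → ℝ, (∃ i, y i = 0) → F y = 0
  integrable : Integrable F (gaussian ι)
  exists_deriv : ∃ D, IsMixedDerivFamily α F D ∧ normOfFamily α D < ⊤

end AnchoredSpace

/-! ### The lognormal diffusion problem -/

section PDE

variable {d : ℕ} (Ω : Opens (EuclideanSpace ℝ (Fin d)))

/-- `κ = ‖∑_j |φ_j| / b_j‖_{L^∞(Ω)}`. -/
def kappa (φ : ℕ → EuclideanSpace ℝ (Fin d) → ℝ) (b : ℕ → ℝ) : ℝ≥0∞ :=
  essSup (fun x => ∑' j, ENNReal.ofReal (|φ j x| / b j))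
    (volume.restrict (Ω : Set (EuclideanSpace ℝ (Fin d))))

/-- The truncated lognormal coefficient `a(x, y_v) = exp (∑_{j ∈ v} y_j φ_j(x))`. -/
def coeff (φ : ℕ → EuclideanSpace ℝ (Fin d) → ℝ) (v : Finset ℕ) (y : ℕ → ℝ)
    (x : EuclideanSpace ℝ (Fin d)) : ℝ :=
  Real.exp (∑ j ∈ v, y j * φ j x)

variable [NeZero d] [Fact (Bornology.IsBounded (Ω : Set (EuclideanSpace ℝ (Fin d))))]

/-- `u ∈ W` solves `∫_Ω a ∇u · ∇w = f(w)` for all `w ∈ W`. For `W = ⊤` this is the weak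
formulation of `-∇ · (a ∇u) = f` with homogeneous Dirichlet conditions; for finite-dimensional `W`
it is the Galerkin (finite element) discretization. -/
def IsSolution (W : Submodule ℝ (H10 Ω)) (a : EuclideanSpace ℝ (Fin d) → ℝ)
    (f : StrongDual ℝ (H10 Ω)) (u : H10 Ω) : Prop :=
  u ∈ W ∧ ∀ w ∈ W,
    ∫ x in (Ω : Set (EuclideanSpace ℝ (Fin d))), a x * ⟪grad Ω u x, grad Ω w x⟫ = f w

open Classical in
/-- The solution in `W` (with value `0` if there were none). -/
def solution (W : Submodule ℝ (H10 Ω)) (a : EuclideanSpace ℝ (Fin d) → ℝ)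
    (f : StrongDual ℝ (H10 Ω)) : H10 Ω :=
  if h : ∃ u, IsSolution Ω W a f u then h.choose else 0

/-- The anchored-decomposition term `u_𝔲(y) = ∑_{v ⊆ 𝔲} (-1)^{|𝔲|-|v|} u(·, y_v)`, `y ∈ ℝ^𝔲`,
where `u(·, y_v)` is the solution in `W` with coefficient `a(·, y_v)`. -/
def anchoredTerm (W : Submodule ℝ (H10 Ω)) (φ : ℕ → EuclideanSpace ℝ (Fin d) → ℝ)
    (f : StrongDual ℝ (H10 Ω)) (𝔲 : Finset ℕ) (y : 𝔲 → ℝ) : H10 Ω :=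
  ∑ v ∈ 𝔲.powerset, (-1 : ℝ) ^ (𝔲.card - v.card) •
    solution Ω W (coeff φ v (glue (fun j => j ∈ 𝔲) y 0)) f

end PDE

/-- `C'_{κ,α} = (∑_{k ≥ 0} δ^k)^{1/2} exp (∑_j [(κ b_j)² + 2 κ b_j / √(2π)])`. -/
def constC' (κ δ : ℝ) (b : ℕ → ℝ) : ℝ :=
  Real.sqrt (∑' k : ℕ, δ ^ k) *
    Real.exp (∑' j, ((κ * b j) ^ 2 + 2 * κ * b j / Real.sqrt (2 * Real.pi)))

end LognormalPDE

end

/-! Let `W` be `V` or `V^h`. Only two facts about `W` matter: it is complete, and the gradient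
embeds it isometrically in L². Hence the constants do not depend on `V^h`. Since |φ_j| ≤ κ b_j
almost everywhere, the coefficient a = exp(∑ y_j φ_j) is pulled back from a continuous function on a
compact cube. The continuous functions form a commutative Banach algebra, and the problem reads
T(exp(∑ y_j P_j)) U = F with T bounded and linear. Lax–Milgram makes these operators invertible and
inversion is smooth, so U is smooth in y (`contDiff_of_apply_eq`).

Differentiating (`leibniz_of_apply_eq`) gives ∑_{m ≤ τ} C(τ,m) ∫ φ^{τ-m} a ∇∂^m u · ∇w = 0 for τ ≠
0. Take w = ∂^τ u, weight by b^{-2τ}, and sum over all nonzero τ ≤ (α, …, α). The pointwise kernel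
C(τ,m) |φ/b|^{τ-m} is 1 on the diagonal, and its off-diagonal row and column sums are at most
exp(ακ) - 1 ≤ 2^δ - 1 ≤ δ. A Schur test then absorbs the off-diagonal part for all orders at once,
without induction on the order (`sum_inner_lower_bound`, `energy_estimate`). The weighted
derivatives are bounded by (1-δ)⁻¹ = ∑ δ^k times the energy of u.

The norm involves only τ with every τ_j ≥ 1. For these, all terms of the anchored sum except v = 𝔲
are differentiated away, and b^τ ≤ ∏ b_j because b_j ≤ 1. The energy bound for u and the passage
from the a-weighted norm to that of `V` each cost a factor exp(∑ κ b_j |y_j|). Integrating their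
product against the Gaussian gives the square of the exponential in C'
(`lintegral_exp_mul_abs_gaussianReal_le`). Grouping τ by the set {j : τ_j = α} gives 2^{|𝔲|} classes
with the same bound (`normOfFamily_le`). -/

noncomputable section

set_option linter.unusedSectionVars false

namespace LognormalPDE

/-! ### Families of mixed partial derivatives of smooth functions -/

section SmoothFamily

variable {ι : Type*} [Fintype ι] [DecidableEq ι] {E : Type*} [NormedAddCommGroup E]
  [NormedSpace ℝ E]

/-- `D τ` is the mixed partial derivative `∂^τ F`, for a smooth function `F` and all `τ`. -/
structure IsSmoothFamily (F : (ι → ℝ) → E) (D : (ι → ℕ) → (ι → ℝ) → E) : Prop where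
  zero : D 0 = F
  continuous : ∀ τ, Continuous (D τ)
  hasDerivAt : ∀ τ j y, HasDerivAt (fun t => D τ (Function.update y j t))
    (D (τ + Pi.single j 1) y) (y j)

theorem IsSmoothFamily.hasDerivAt' {F : (ι → ℝ) → E} {D : (ι → ℕ) → (ι → ℝ) → E}
    (hD : IsSmoothFamily F D) (τ : ι → ℕ) (j : ι) (y : ι → ℝ) (t : ℝ) :
    HasDerivAt (fun t => D τ (Function.update y j t))
      (D (τ + Pi.single j 1) (Function.update y j t)) t := by
  simpa using hD.hasDerivAt τ j (Function.update y j t)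

/-- The partial derivative of a smooth function in the direction `j`. -/
def pderiv (j : ι) (g : {g : (ι → ℝ) → E // ContDiff ℝ ∞ g}) :
    {g : (ι → ℝ) → E // ContDiff ℝ ∞ g} :=
  ⟨fun y => fderiv ℝ g.1 y (Pi.single j 1),
    (g.2.fderiv_right (m := ∞) (by simp)).clm_apply contDiff_const⟩

/-- Symmetry of the second derivative. It makes iterated partial derivatives along a multiset of
directions independent of the order. -/
instance : LeftCommutative (pderiv (ι := ι) (E := E)) where
  left_comm i j g := by
    have h1 : ∀ y, DifferentiableAt ℝ (fderiv ℝ g.1) y := fun y =>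
      ((g.2.fderiv_right (m := ∞) (by simp)).differentiable (by simp)) y
    have h2 : ∀ (k l : ι) (y : ι → ℝ), (pderiv k (pderiv l g)).1 y
        = fderiv ℝ (fderiv ℝ g.1) y (Pi.single k 1) (Pi.single l 1) := fun k l y => by
      have := fderiv_clm_apply (h1 y) (differentiableAt_const (c := (Pi.single l 1 : ι → ℝ)))
      simp only [pderiv]
      rw [this]
      simp
    refine Subtype.ext (funext fun y => ?_)
    rw [h2, h2]
    exact (g.2.contDiffAt.isSymmSndFDerivAt (by simp; exact WithTop.coe_le_coe.mpr le_top)).eq _ _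

/-- The multi-index τ is encoded as the multiset containing each i exactly `τ i` times, and `pderiv`
is folded over it. Raising `τ j` by one adds one more j. -/
theorem exists_isSmoothFamily {F : (ι → ℝ) → E} (hF : ContDiff ℝ ∞ F) :
    ∃ D, IsSmoothFamily F D := by
  refine ⟨fun τ => ((∑ i, τ i • ({i} : Multiset ι)).foldr pderiv ⟨F, hF⟩).1, by simp,
    fun τ => Subtype.prop (_ : {g : (ι → ℝ) → E // ContDiff ℝ ∞ g}) |>.continuous,
    fun τ j y => ?_⟩
  have h1 : ∑ i, (τ + Pi.single j 1 : ι → ℕ) i • ({i} : Multiset ι)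
      = j ::ₘ ∑ i, τ i • ({i} : Multiset ι) := by
    simp only [Pi.add_apply, add_smul, Finset.sum_add_distrib]
    rw [Finset.sum_eq_single j (f := fun i => (Pi.single j 1 : ι → ℕ) i • ({i} : Multiset ι))
      (fun i _ hi => by simp [hi]) (by simp)]
    simp [add_comm]
  simp only [h1, Multiset.foldr_cons]
  set g := (∑ i, τ i • ({i} : Multiset ι)).foldr pderiv ⟨F, hF⟩
  have h2 : HasFDerivAt g.1 (fderiv ℝ g.1 y) (Function.update y j (y j)) := by
    rw [Function.update_eq_self]
    exact ((g.2.differentiable (by simp)) y).hasFDerivAt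
  exact h2.comp_hasDerivAt (y j) (hasDerivAt_update y j (y j))

theorem IsSmoothFamily.clm_comp {E' : Type*} [NormedAddCommGroup E'] [NormedSpace ℝ E']
    {F : (ι → ℝ) → E} {D : (ι → ℕ) → (ι → ℝ) → E}
    (hD : IsSmoothFamily F D) (S : E →L[ℝ] E') :
    IsSmoothFamily (fun y => S (F y)) (fun τ y => S (D τ y)) where
  zero := by simp only [hD.zero]
  continuous τ := S.continuous.comp (hD.continuous τ)
  hasDerivAt τ j y := S.hasFDerivAt.comp_hasDerivAt _ (hD.hasDerivAt τ j y)

theorem IsSmoothFamily.isMixedDerivFamily [CompleteSpace E] {F : (ι → ℝ) → E}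
    {D : (ι → ℕ) → (ι → ℝ) → E} (hD : IsSmoothFamily F D) (α : ℕ) :
    IsMixedDerivFamily α F D where
  zero := hD.zero
  measurable τ _ w := by
    refine ((hD.continuous τ).comp ?_).aestronglyMeasurable
    refine continuous_pi fun i => ?_
    unfold glue
    split_ifs with h
    · exact continuous_apply _
    · exact continuous_const
  ftc τ _ j _ := by
    refine Filter.Eventually.of_forall fun z w t => ?_
    have hu : Function.update τ j (τ j + 1) = τ + Pi.single j 1 := by
      ext i
      by_cases h : i = j
      · subst h; simp
      · simp [h]
    rw [hu]
    have hc : Continuous fun r => D (τ + Pi.single j 1)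
        (Function.update (glue (fun i => τ i = α) z w) j r) :=
      (hD.continuous _).comp (continuous_const.update j continuous_id)
    refine ⟨hc.intervalIntegrable _ _, ?_⟩
    rw [intervalIntegral.integral_eq_sub_of_hasDerivAt
      (fun r _ => hD.hasDerivAt' τ j _ r) (hc.intervalIntegrable _ _)]
    abel

end SmoothFamily

/-! ### Multi-index binomial coefficients -/

section MultiChoose

variable {ι : Type*} [Fintype ι] [DecidableEq ι]

/-- The binomial coefficient of multi-indices. -/
def multiChoose (τ m : ι → ℕ) : ℕ := ∏ i, (τ i).choose (m i)

theorem multiChoose_add_single_add_single (τ m : ι → ℕ) (j : ι) :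
    multiChoose (τ + Pi.single j 1) (m + Pi.single j 1)
      = multiChoose τ m + multiChoose τ (m + Pi.single j 1) := by
  have h : ∀ a b : ι → ℕ, multiChoose a b
      = (a j).choose (b j) * ∏ i ∈ Finset.univ.erase j, (a i).choose (b i) := fun a b =>
    (Finset.mul_prod_erase _ _ (Finset.mem_univ j)).symm
  have h1 : ∀ a b a' b' : ι → ℕ, (∀ i, i ≠ j → a i = a' i) → (∀ i, i ≠ j → b i = b' i) →
      ∏ i ∈ Finset.univ.erase j, (a i).choose (b i)
        = ∏ i ∈ Finset.univ.erase j, (a' i).choose (b' i) := fun a b a' b' ha hb =>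
    Finset.prod_congr rfl fun i hi => by
      rw [ha i (Finset.ne_of_mem_erase hi), hb i (Finset.ne_of_mem_erase hi)]
  rw [h, h, h, h1 (τ + Pi.single j 1) (m + Pi.single j 1) τ m (fun i hi => by simp [hi])
      (fun i hi => by simp [hi]), h1 τ (m + Pi.single j 1) τ m (fun _ _ => rfl)
      (fun i hi => by simp [hi])]
  simp [Nat.choose_succ_succ, add_mul]

theorem multiChoose_add_single_of_eq_zero (τ m : ι → ℕ) (j : ι) (hm : m j = 0) :
    multiChoose (τ + Pi.single j 1) m = multiChoose τ m := by
  refine Finset.prod_congr rfl fun i _ => ?_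
  by_cases h : i = j
  · subst h; simp [hm]
  · simp [h]

theorem multiChoose_eq_zero (τ m : ι → ℕ) (h : ¬ m ≤ τ) : multiChoose τ m = 0 := by
  simp only [Pi.le_def, not_forall, not_le] at h
  obtain ⟨i, hi⟩ := h
  exact Finset.prod_eq_zero (Finset.mem_univ i) (Nat.choose_eq_zero_of_lt hi)

theorem multiChoose_self (τ : ι → ℕ) : multiChoose τ τ = 1 := by
  simp [multiChoose]

/-- The indices with m j ≠ 0 are exactly the shifts by one in direction j of the indices below τ;
this matches the two terms of Pascal's rule. -/
theorem sum_Iic_add_single {M : Type*} [AddCommMonoid M] (τ : ι → ℕ) (j : ι)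
    (g : (ι → ℕ) → M) :
    ∑ m ∈ Finset.Iic (τ + Pi.single j 1), g m
      = ∑ m ∈ Finset.Iic (τ + Pi.single j 1) with m j = 0, g m
        + ∑ m ∈ Finset.Iic τ, g (m + Pi.single j 1) := by
  rw [← Finset.sum_filter_add_sum_filter_not _ (fun m : ι → ℕ => m j = 0)]
  congr 1
  refine Finset.sum_nbij' (fun m => m - Pi.single j 1) (fun m => m + Pi.single j 1) ?_ ?_ ?_ ?_ ?_
  · intro m hm
    simp only [Finset.mem_filter, Finset.mem_Iic] at hm
    simpa using tsub_le_iff_right.mpr hm.1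
  · intro m hm
    simp only [Finset.mem_filter, Finset.mem_Iic] at hm ⊢
    exact ⟨by gcongr, by simp⟩
  · intro m hm
    simp only [Finset.mem_filter] at hm
    refine tsub_add_cancel_of_le ?_
    intro i
    by_cases h : i = j
    · subst h; simpa using Nat.one_le_iff_ne_zero.mpr hm.2
    · simp [h]
  · intro m _
    exact add_tsub_cancel_right _ _
  · intro m hm
    simp only [Finset.mem_filter] at hm
    congr 1
    refine (tsub_add_cancel_of_le ?_).symm
    intro i
    by_cases h : i = j
    · subst h; simpa using Nat.one_le_iff_ne_zero.mpr hm.2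
    · simp [h]

/-- One step of the Leibniz rule: `X n m` stands for a product of an `n`-th derivative with an
`m`-th derivative. -/
theorem sum_multiChoose_smul_add_single {M : Type*} [AddCommMonoid M]
    (τ : ι → ℕ) (j : ι) (X : (ι → ℕ) → (ι → ℕ) → M) :
    ∑ m ∈ Finset.Iic (τ + Pi.single j 1),
        multiChoose (τ + Pi.single j 1) m • X (τ + Pi.single j 1 - m) m
      = ∑ m ∈ Finset.Iic τ, multiChoose τ m •
          (X (τ - m + Pi.single j 1) m + X (τ - m) (m + Pi.single j 1)) := by
  -- The additional indices in the larger range carry a vanishing binomial coefficient.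
  have hX : ∑ m ∈ Finset.Iic τ, multiChoose τ m • X (τ - m + Pi.single j 1) m
      = ∑ m ∈ Finset.Iic (τ + Pi.single j 1),
          multiChoose τ m • X (τ + Pi.single j 1 - m) m := by
    rw [← Finset.sum_subset (Finset.Iic_subset_Iic.mpr (le_self_add : τ ≤ τ + Pi.single j 1))]
    · refine Finset.sum_congr rfl fun m hm => ?_
      rw [tsub_add_eq_add_tsub (Finset.mem_Iic.mp hm)]
    · intro m _ hm
      rw [multiChoose_eq_zero τ m (by simpa using hm), zero_smul]
  simp only [smul_add, Finset.sum_add_distrib]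
  rw [hX, sum_Iic_add_single, sum_Iic_add_single, add_assoc]
  congr 1
  · refine Finset.sum_congr rfl fun m hm => ?_
    rw [multiChoose_add_single_of_eq_zero _ _ _ (Finset.mem_filter.mp hm).2]
  · rw [← Finset.sum_add_distrib]
    refine Finset.sum_congr rfl fun m _ => ?_
    rw [multiChoose_add_single_add_single, add_smul, add_tsub_add_eq_tsub_right, add_comm]

end MultiChoose

/-! ### Linear equations with an exponential coefficient in a commutative Banach algebra -/

section AbstractEquation

variable {ι : Type*} [Fintype ι] [DecidableEq ι]
  {𝒜 : Type*} [NormedCommRing 𝒜] [NormedAlgebra ℝ 𝒜] [CompleteSpace 𝒜]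

/-- `exp (∑ y_j P_j)`. -/
def expCoeff (P : ι → 𝒜) (y : ι → ℝ) : 𝒜 := NormedSpace.exp (∑ i, y i • P i)

theorem contDiff_expCoeff (P : ι → 𝒜) : ContDiff ℝ ∞ (expCoeff P) := by
  have h1 : ContDiff ℝ ∞ (NormedSpace.exp : 𝒜 → 𝒜) :=
    AnalyticOnNhd.contDiff fun x _ => NormedSpace.exp_analytic (𝕂 := ℝ) x
  exact h1.comp (ContDiff.sum fun i _ => (contDiff_apply ℝ ℝ i).smul contDiff_const)

/-- Commutativity of the algebra is essential: otherwise P j could not be pulled out of the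
derivative of the exponential. -/
theorem hasDerivAt_expCoeff (P : ι → 𝒜) (j : ι) (y : ι → ℝ) :
    HasDerivAt (fun t => expCoeff P (Function.update y j t)) (P j * expCoeff P y) (y j) := by
  have h1 : HasDerivAt (fun t => ∑ i, Function.update y j t i • P i) (P j) (y j) := by
    have h2 : HasDerivAt (fun t => ∑ i, Function.update y j t i • P i)
        (∑ i, (Pi.single j 1 : ι → ℝ) i • P i) (y j) :=
      HasDerivAt.fun_sum fun i _ =>
        ((hasDerivAt_pi.mp (hasDerivAt_update y j (y j))) i).smul_const (P i)
    rw [Finset.sum_eq_single j (fun i _ hi => by simp [hi]) (by simp)] at h2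
    simpa using h2
  have h3 := (hasFDerivAt_exp (𝕂 := ℝ)
    (x := ∑ i, Function.update y j (y j) i • P i)).comp_hasDerivAt (y j) h1
  refine HasDerivAt.congr_deriv (f := fun t => expCoeff P (Function.update y j t)) h3 ?_
  simp [expCoeff, mul_comm]

variable {W W' : Type*} [NormedAddCommGroup W] [NormedSpace ℝ W] [CompleteSpace W]
  [NormedAddCommGroup W'] [NormedSpace ℝ W']

/-- U is the composition of the exponential, the linear map T, operator inversion and evaluation at
F; inversion is smooth near every invertible operator. -/
theorem contDiff_of_apply_eq {P : ι → 𝒜} {T : 𝒜 →L[ℝ] W →L[ℝ] W'}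
    (hT : ∀ y, ∃ e : W ≃L[ℝ] W', (e : W →L[ℝ] W') = T (expCoeff P y))
    {F : W'} {U : (ι → ℝ) → W} (hU : ∀ y, T (expCoeff P y) (U y) = F) :
    ContDiff ℝ ∞ U := by
  have h1 : U = fun y => (T (expCoeff P y)).inverse F := by
    funext y
    obtain ⟨e, he⟩ := hT y
    rw [← hU y, ← he]
    simp
  rw [h1, contDiff_iff_contDiffAt]
  intro y
  refine ContDiffAt.clm_apply ?_ contDiffAt_const
  obtain ⟨e, he⟩ := hT y
  have h2 := contDiffAt_map_inverse (𝕜 := ℝ) (n := ∞) e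
  rw [he] at h2
  exact h2.comp y (T.contDiff.comp (contDiff_expCoeff P)).contDiffAt

/-- The differentiated equations, by the Leibniz rule. -/
theorem leibniz_of_apply_eq {P : ι → 𝒜} {T : 𝒜 →L[ℝ] W →L[ℝ] W'} {F : W'}
    {U : (ι → ℝ) → W} (hU : ∀ y, T (expCoeff P y) (U y) = F)
    {D : (ι → ℕ) → (ι → ℝ) → W} (hD : IsSmoothFamily U D) (τ : ι → ℕ) (y : ι → ℝ) :
    ∑ m ∈ Finset.Iic τ, multiChoose τ m •
      T ((∏ i, P i ^ (τ - m) i) * expCoeff P y) (D m y) = if τ = 0 then F else 0 := by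
  induction hn : ∑ i, τ i generalizing τ y with
  | zero =>
    have h0 : τ = 0 := by
      funext i
      simpa using (Finset.sum_eq_zero_iff.mp hn) i (Finset.mem_univ i)
    subst h0
    have h1 : Finset.Iic (0 : ι → ℕ) = {0} := by
      ext m
      simp
    simp [h1, multiChoose_self, hD.zero, hU]
  | succ n ih =>
    obtain ⟨j, hj⟩ : ∃ j, τ j ≠ 0 := by
      by_contra! h
      simp [h] at hn
    obtain ⟨σ, rfl⟩ : ∃ σ, τ = σ + Pi.single j 1 := by
      refine ⟨τ - Pi.single j 1, (tsub_add_cancel_of_le fun i => ?_).symm⟩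
      by_cases h : i = j
      · subst h; simpa using Nat.one_le_iff_ne_zero.mpr hj
      · simp [h]
    have hσ : ∑ i, σ i = n := by
      simp only [Pi.add_apply, Finset.sum_add_distrib, Finset.sum_pi_single', Finset.mem_univ,
        if_true] at hn
      omega
    have hne : σ + Pi.single j 1 ≠ 0 := fun h => hj (by rw [h]; rfl)
    rw [if_neg hne, sum_multiChoose_smul_add_single σ j
      (fun n m => T ((∏ i, P i ^ n i) * expCoeff P y) (D m y))]
    have hP : ∀ n : ι → ℕ, ∏ i, P i ^ (n + Pi.single j 1 : ι → ℕ) i = (∏ i, P i ^ n i) * P j := by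
      intro n
      simp only [Pi.add_apply, pow_add, Finset.prod_mul_distrib]
      rw [Finset.prod_eq_single j (f := fun i => P i ^ (Pi.single j 1 : ι → ℕ) i)
        (fun i _ hi => by simp [hi]) (by simp)]
      simp
    have hder : HasDerivAt (fun t => ∑ m ∈ Finset.Iic σ, multiChoose σ m •
        T ((∏ i, P i ^ (σ - m) i) * expCoeff P (Function.update y j t))
          (D m (Function.update y j t)))
        (∑ m ∈ Finset.Iic σ, multiChoose σ m •
          (T ((∏ i, P i ^ (σ - m + Pi.single j 1 : ι → ℕ) i) * expCoeff P y) (D m y)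
            + T ((∏ i, P i ^ (σ - m) i) * expCoeff P y) (D (m + Pi.single j 1) y))) (y j) := by
      refine HasDerivAt.fun_sum fun m _ => ?_
      have h1 : HasDerivAt
          (fun t => T ((∏ i, P i ^ (σ - m) i) * expCoeff P (Function.update y j t)))
          (T ((∏ i, P i ^ (σ - m + Pi.single j 1 : ι → ℕ) i) * expCoeff P y)) (y j) := by
        rw [hP, mul_assoc]
        exact T.hasFDerivAt.comp_hasDerivAt _ ((hasDerivAt_expCoeff P j y).const_mul _)
      refine HasDerivAt.congr_deriv ((h1.clm_apply (hD.hasDerivAt m j y)).const_smul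
        (multiChoose σ m)) ?_
      simp
    -- By induction the identity for σ holds at every parameter value, so the differentiated
    -- function is constant in t and its derivative is also 0.
    have hconst := hder.unique (by
      simp only [ih σ _ hσ]
      exact hasDerivAt_const _ _)
    exact hconst

end AbstractEquation

/-! ### The energy estimate for the mixed derivatives -/

section Energy

theorem sum_choose_mul_pow_le_exp_left {α t : ℕ} (ht : t ≤ α) {c : ℝ} (hc : 0 ≤ c) :
    ∑ m ∈ Finset.range (α + 1), (t.choose m : ℝ) * c ^ (t - m) ≤ Real.exp (α * c) := by
  have h1 : ∑ m ∈ Finset.range (α + 1), (t.choose m : ℝ) * c ^ (t - m) = (1 + c) ^ t := by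
    rw [add_pow, ← Finset.sum_subset
      (Finset.range_subset_range.mpr (Nat.succ_le_succ ht) : Finset.range (t + 1) ⊆ _)]
    · exact Finset.sum_congr rfl fun m _ => by simp [mul_comm]
    · intro m _ hm
      simp only [Finset.mem_range, not_lt] at hm
      simp [Nat.choose_eq_zero_of_lt (Nat.lt_of_succ_le hm)]
  rw [h1]
  calc (1 + c) ^ t ≤ Real.exp c ^ t := by
        gcongr
        rw [add_comm]
        exact Real.add_one_le_exp c
    _ = Real.exp (t * c) := (Real.exp_nat_mul c t).symm
    _ ≤ Real.exp (α * c) := by gcongr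

/-- Here the upper index runs, so the binomial theorem does not apply. With t = m + n ≤ α one has
C(m+n, n) ≤ α^n / n!, and a partial sum of the exponential series appears. -/
theorem sum_choose_mul_pow_le_exp_right (α m : ℕ) {c : ℝ} (hc : 0 ≤ c) :
    ∑ t ∈ Finset.range (α + 1), (t.choose m : ℝ) * c ^ (t - m) ≤ Real.exp (α * c) := by
  rcases lt_or_ge α m with h | h
  · rw [Finset.sum_eq_zero fun t ht => ?_]
    · positivity
    · simp [Nat.choose_eq_zero_of_lt ((Nat.le_of_lt_succ (Finset.mem_range.mp ht)).trans_lt h)]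
  · have h1 : ∑ t ∈ Finset.range (α + 1), (t.choose m : ℝ) * c ^ (t - m)
        = ∑ n ∈ Finset.range (α + 1 - m), ((m + n).choose m : ℝ) * c ^ n := by
      rw [← Finset.sum_range_add_sum_Ico _ (h.trans (Nat.le_succ α)),
        Finset.sum_eq_zero fun t ht => by simp [Nat.choose_eq_zero_of_lt (Finset.mem_range.mp ht)],
        zero_add, Finset.sum_Ico_eq_sum_range]
      simp
    rw [h1]
    refine le_trans (Finset.sum_le_sum fun n hn => ?_)
      (Real.sum_le_exp_of_nonneg (by positivity) (α + 1 - m))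
    have hn' : m + n ≤ α := by
      have := Finset.mem_range.mp hn
      omega
    have h2 : ((m + n).choose m : ℝ) ≤ (α : ℝ) ^ n / n.factorial := by
      rw [Nat.choose_symm_add]
      refine (Nat.choose_le_pow_div (α := ℝ) n (m + n)).trans ?_
      gcongr
    calc ((m + n).choose m : ℝ) * c ^ n ≤ (α : ℝ) ^ n / n.factorial * c ^ n := by gcongr
      _ = (α * c) ^ n / n.factorial := by ring

variable {ι : Type*} [Fintype ι] [DecidableEq ι]

/-- The multi-indices `τ ≤ (α, …, α)`. -/
def box (ι : Type*) [Fintype ι] [DecidableEq ι] (α : ℕ) : Finset (ι → ℕ) :=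
  Fintype.piFinset fun _ => Finset.range (α + 1)

theorem mem_box {α : ℕ} {τ : ι → ℕ} : τ ∈ box ι α ↔ ∀ i, τ i ≤ α := by
  simp [box, Fintype.mem_piFinset]

/-- Both this bound and the next factor over the coordinates, since a sum over the box of products
is a product of one-dimensional sums. -/
theorem sum_multiChoose_mul_le_left {α : ℕ} {τ : ι → ℕ} (hτ : τ ∈ box ι α) {c : ι → ℝ}
    (hc : ∀ i, 0 ≤ c i) :
    ∑ m ∈ box ι α, (multiChoose τ m : ℝ) * ∏ i, c i ^ (τ - m) i
      ≤ Real.exp (α * ∑ i, c i) := by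
  rw [mem_box] at hτ
  simp only [multiChoose, Nat.cast_prod, ← Finset.prod_mul_distrib, Pi.sub_apply, box]
  rw [← Finset.prod_univ_sum (fun _ => Finset.range (α + 1))
    (fun i m => ((τ i).choose m : ℝ) * c i ^ (τ i - m)), Finset.mul_sum, Real.exp_sum]
  exact Finset.prod_le_prod (fun i _ => Finset.sum_nonneg fun m _ =>
    mul_nonneg (by positivity) (pow_nonneg (hc i) _))
    fun i _ => sum_choose_mul_pow_le_exp_left (hτ i) (hc i)

theorem sum_multiChoose_mul_le_right (α : ℕ) (m : ι → ℕ) {c : ι → ℝ} (hc : ∀ i, 0 ≤ c i) :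
    ∑ τ ∈ box ι α, (multiChoose τ m : ℝ) * ∏ i, c i ^ (τ - m) i
      ≤ Real.exp (α * ∑ i, c i) := by
  simp only [multiChoose, Nat.cast_prod, ← Finset.prod_mul_distrib, Pi.sub_apply, box]
  rw [← Finset.prod_univ_sum (fun _ => Finset.range (α + 1))
    (fun i t => (t.choose (m i) : ℝ) * c i ^ (t - m i)), Finset.mul_sum, Real.exp_sum]
  exact Finset.prod_le_prod (fun i _ => Finset.sum_nonneg fun t _ =>
    mul_nonneg (by positivity) (pow_nonneg (hc i) _))
    fun i _ => sum_choose_mul_pow_le_exp_right α (m i) (hc i)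

/-- Bernoulli's inequality 2^δ ≤ 1 + δ. This is where the constant ln 2 in the smallness condition
comes from. -/
theorem exp_le_one_add {δ s : ℝ} (h0 : 0 ≤ δ) (h1 : δ ≤ 1) (hs : s ≤ δ * Real.log 2) :
    Real.exp s ≤ 1 + δ := by
  have h2 := rpow_one_add_le_one_add_mul_self (s := 1) (by norm_num) h0 h1
  rw [Real.rpow_def_of_pos (by norm_num)] at h2
  norm_num at h2
  refine le_trans ?_ h2
  gcongr
  linarith

variable {H : Type*} [NormedAddCommGroup H] [InnerProductSpace ℝ H]

/-- A Schur test: the diagonal gives ∑ ‖g τ‖², and ⟪g m, g τ⟫ is split evenly by Young's inequality.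
Rows run over τ ≠ 0 only, so `g 0` enters just through its column, with factor δ/2. -/
theorem sum_inner_lower_bound {α : ℕ} {ψ : ι → ℝ} {δ : ℝ} (h0 : 0 ≤ δ) (h1 : δ ≤ 1)
    (hψ : α * ∑ i, |ψ i| ≤ δ * Real.log 2) (g : (ι → ℕ) → H) :
    (1 - δ) * ∑ τ ∈ (box ι α).erase 0, ‖g τ‖ ^ 2 - δ / 2 * ‖g 0‖ ^ 2
      ≤ ∑ τ ∈ (box ι α).erase 0, ∑ m ∈ Finset.Iic τ,
          (multiChoose τ m : ℝ) * ((∏ i, ψ i ^ (τ - m) i) * ⟪g m, g τ⟫) := by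
  have hq := exp_le_one_add h0 h1 hψ
  set k : (ι → ℕ) → (ι → ℕ) → ℝ := fun τ m => (multiChoose τ m : ℝ) * ∏ i, |ψ i| ^ (τ - m) i
    with hk
  have hk0 : ∀ τ m, 0 ≤ k τ m := fun τ m => by positivity
  have hkd : ∀ τ, k τ τ = 1 := fun τ => by simp [hk, multiChoose_self]
  have hz : (0 : ι → ℕ) ∈ box ι α := by simp [mem_box]
  have hrow : ∀ τ ∈ box ι α, ∑ m ∈ (box ι α).erase τ, k τ m ≤ δ := fun τ hτ => by
    have h2 := sum_multiChoose_mul_le_left hτ (c := fun i => |ψ i|) (fun i => abs_nonneg _)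
    have h3 := Finset.add_sum_erase _ (k τ) hτ
    rw [hkd] at h3
    simp only [hk] at h3 ⊢
    linarith
  have hcol : ∀ m ∈ box ι α, ∑ τ ∈ (box ι α).erase m, k τ m ≤ δ := fun m hm => by
    have h2 := sum_multiChoose_mul_le_right α m (c := fun i => |ψ i|) (fun i => abs_nonneg _)
    have h3 := Finset.add_sum_erase _ (fun τ => k τ m) hm
    simp only [hkd] at h3
    simp only [hk] at h3 ⊢
    linarith
  have hinner : ∀ τ ∈ (box ι α).erase 0,
      ‖g τ‖ ^ 2 - ∑ m ∈ (box ι α).erase τ, k τ m * ((‖g m‖ ^ 2 + ‖g τ‖ ^ 2) / 2)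
        ≤ ∑ m ∈ Finset.Iic τ, (multiChoose τ m : ℝ) * ((∏ i, ψ i ^ (τ - m) i) * ⟪g m, g τ⟫) := by
    intro τ hτ
    have hτ' := mem_box.mp (Finset.mem_of_mem_erase hτ)
    have h2 : ∑ m ∈ Finset.Iic τ,
          (multiChoose τ m : ℝ) * ((∏ i, ψ i ^ (τ - m) i) * ⟪g m, g τ⟫)
        = ∑ m ∈ box ι α,
          (multiChoose τ m : ℝ) * ((∏ i, ψ i ^ (τ - m) i) * ⟪g m, g τ⟫) := by
      refine Finset.sum_subset (fun m hm => mem_box.mpr fun i =>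
        (Finset.mem_Iic.mp hm i).trans (hτ' i)) fun m _ hm => ?_
      rw [multiChoose_eq_zero τ m (by simpa using hm)]
      simp
    rw [h2, ← Finset.add_sum_erase _ _ (Finset.mem_of_mem_erase hτ), multiChoose_self,
      sub_eq_add_neg, ← Finset.sum_neg_distrib]
    refine add_le_add (by simp) (Finset.sum_le_sum fun m _ => ?_)
    have h3 : |⟪g m, g τ⟫| ≤ (‖g m‖ ^ 2 + ‖g τ‖ ^ 2) / 2 := by
      have := abs_real_inner_le_norm (g m) (g τ)
      nlinarith [sq_nonneg (‖g m‖ - ‖g τ‖)]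
    refine (neg_le_neg ?_).trans (neg_abs_le _)
    rw [abs_mul, abs_mul, Finset.abs_prod, Nat.abs_cast, ← mul_assoc]
    simp only [abs_pow]
    exact mul_le_mul_of_nonneg_left h3 (hk0 τ m)
  refine le_trans ?_ (Finset.sum_le_sum hinner)
  rw [Finset.sum_sub_distrib]
  -- The ‖g m‖² half is controlled by column sums after exchanging the summations, the ‖g τ‖² half
  -- by row sums.
  have hsplit : ∑ τ ∈ (box ι α).erase 0, ∑ m ∈ (box ι α).erase τ,
        k τ m * ((‖g m‖ ^ 2 + ‖g τ‖ ^ 2) / 2)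
      ≤ δ / 2 * (‖g 0‖ ^ 2 + ∑ τ ∈ (box ι α).erase 0, ‖g τ‖ ^ 2)
        + δ / 2 * ∑ τ ∈ (box ι α).erase 0, ‖g τ‖ ^ 2 := by
    have h4 : ∀ τ m, k τ m * ((‖g m‖ ^ 2 + ‖g τ‖ ^ 2) / 2)
        = k τ m * (‖g m‖ ^ 2 / 2) + k τ m * (‖g τ‖ ^ 2 / 2) := fun τ m => by ring
    simp only [h4, Finset.sum_add_distrib]
    refine add_le_add ?_ ?_
    · rw [Finset.add_sum_erase _ (fun τ => ‖g τ‖ ^ 2) hz, Finset.mul_sum]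
      calc ∑ τ ∈ (box ι α).erase 0, ∑ m ∈ (box ι α).erase τ, k τ m * (‖g m‖ ^ 2 / 2)
          ≤ ∑ τ ∈ box ι α, ∑ m ∈ (box ι α).erase τ, k τ m * (‖g m‖ ^ 2 / 2) :=
            Finset.sum_le_sum_of_subset_of_nonneg (Finset.erase_subset _ _) fun τ _ _ =>
              Finset.sum_nonneg fun m _ => mul_nonneg (hk0 τ m) (by positivity)
        _ = ∑ m ∈ box ι α, ∑ τ ∈ (box ι α).erase m, k τ m * (‖g m‖ ^ 2 / 2) :=
            Finset.sum_comm' fun τ m => by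
              simp only [Finset.mem_erase]
              tauto
        _ ≤ ∑ m ∈ box ι α, δ / 2 * ‖g m‖ ^ 2 := Finset.sum_le_sum fun m hm => by
            rw [← Finset.sum_mul]
            nlinarith [hcol m hm, sq_nonneg ‖g m‖]
    · rw [Finset.mul_sum]
      refine Finset.sum_le_sum fun τ hτ => ?_
      rw [← Finset.sum_mul]
      nlinarith [hrow τ (Finset.mem_of_mem_erase hτ), sq_nonneg ‖g τ‖]
  linarith

variable {X : Type*} [MeasurableSpace X] {μ : Measure X}

/-- The pointwise Schur bound, applied to b^{-τ} g τ and φ/b, is multiplied by the weight a and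
integrated; the right-hand side then vanishes by the differentiated equations. -/
theorem energy_estimate {α : ℕ} {φ : ι → X → ℝ} {b : ι → ℝ} (hb : ∀ i, 0 < b i)
    {δ : ℝ} (h0 : 0 ≤ δ) (h1 : δ < 1)
    (hφ : ∀ᵐ x ∂μ, α * ∑ i, |φ i x / b i| ≤ δ * Real.log 2)
    {a : X → ℝ} (ha : ∀ x, 0 ≤ a x) {g : (ι → ℕ) → X → H}
    (hint : ∀ n m τ : ι → ℕ, Integrable (fun x => ((∏ i, φ i x ^ n i) * a x) * ⟪g m x, g τ x⟫) μ)
    (hg : ∀ τ : ι → ℕ, τ ≠ 0 → ∑ m ∈ Finset.Iic τ, (multiChoose τ m : ℝ) *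
      ∫ x, ((∏ i, φ i x ^ (τ - m) i) * a x) * ⟪g m x, g τ x⟫ ∂μ = 0) :
    ∑ τ ∈ box ι α, ((∏ i, b i ^ τ i)⁻¹) ^ 2 * ∫ x, a x * ‖g τ x‖ ^ 2 ∂μ
      ≤ (1 - δ)⁻¹ * ∫ x, a x * ‖g 0 x‖ ^ 2 ∂μ := by
  set B : (ι → ℕ) → ℝ := fun τ => (∏ i, b i ^ τ i)⁻¹ with hB
  have hBz : B 0 = 1 := by simp [hB]
  have hI : ∀ τ, Integrable (fun x => a x * ‖g τ x‖ ^ 2) μ := fun τ => by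
    simpa using hint 0 τ τ
  have hpt : ∀ᵐ x ∂μ, (1 - δ) * ∑ τ ∈ (box ι α).erase 0, B τ ^ 2 * (a x * ‖g τ x‖ ^ 2)
      - δ / 2 * (a x * ‖g 0 x‖ ^ 2)
      ≤ ∑ τ ∈ (box ι α).erase 0, B τ ^ 2 * ∑ m ∈ Finset.Iic τ, (multiChoose τ m : ℝ) *
          (((∏ i, φ i x ^ (τ - m) i) * a x) * ⟪g m x, g τ x⟫) := by
    filter_upwards [hφ] with x hx
    have h2 := mul_le_mul_of_nonneg_left
      (sum_inner_lower_bound h0 h1.le hx (fun τ => B τ • g τ x)) (ha x)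
    simp only [norm_smul, mul_pow, inner_smul_left, inner_smul_right, hBz, Real.norm_eq_abs,
      sq_abs, abs_one, one_mul, Real.ringHom_apply] at h2
    refine (le_of_eq ?_).trans (h2.trans (le_of_eq ?_))
    · rw [mul_sub, Finset.mul_sum, Finset.mul_sum, Finset.mul_sum]
      congr 1
      · exact Finset.sum_congr rfl fun τ _ => by ring
      · ring
    · rw [Finset.mul_sum]
      refine Finset.sum_congr rfl fun τ _ => ?_
      rw [Finset.mul_sum, Finset.mul_sum]
      refine Finset.sum_congr rfl fun m hm => ?_
      -- The rescaling is consistent: (φ/b)^{τ-m} b^{-m} = φ^{τ-m} b^{-τ}.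
      have h3 : (∏ i, (φ i x / b i) ^ (τ - m) i) * B m = (∏ i, φ i x ^ (τ - m) i) * B τ := by
        simp only [hB, ← Finset.prod_inv_distrib, ← Finset.prod_mul_distrib]
        refine Finset.prod_congr rfl fun i _ => ?_
        have h4 : τ i = (τ i - m i) + m i := (Nat.sub_add_cancel (Finset.mem_Iic.mp hm i)).symm
        have h5 := (hb i).ne'
        simp only [Pi.sub_apply]
        conv_rhs => rw [h4, pow_add]
        simp only [Nat.add_sub_cancel]
        field_simp
        rw [div_pow, div_mul_cancel₀ _ (pow_ne_zero _ h5)]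
      linear_combination ((multiChoose τ m : ℝ) * a x * B τ * ⟪g m x, g τ x⟫) * h3
  have hJ : ∀ τ m : ι → ℕ, Integrable (fun x => (multiChoose τ m : ℝ) *
          (((∏ i, φ i x ^ (τ - m) i) * a x) * ⟪g m x, g τ x⟫)) μ := fun τ m =>
    (hint (τ - m) m τ).const_mul _
  have hS : Integrable (fun x => ∑ τ ∈ (box ι α).erase 0, B τ ^ 2 * (a x * ‖g τ x‖ ^ 2)) μ :=
    integrable_finsetSum _ fun τ _ => (hI τ).const_mul _
  have hmono := integral_mono_ae ((hS.const_mul (1 - δ)).sub ((hI 0).const_mul (δ / 2)))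
    (integrable_finsetSum _ fun τ _ => (integrable_finsetSum _ fun m _ => hJ τ m).const_mul _) hpt
  have hR : ∫ x, ∑ τ ∈ (box ι α).erase 0, B τ ^ 2 * ∑ m ∈ Finset.Iic τ, (multiChoose τ m : ℝ) *
          (((∏ i, φ i x ^ (τ - m) i) * a x) * ⟪g m x, g τ x⟫) ∂μ = 0 := by
    rw [integral_finsetSum _ fun τ _ => (integrable_finsetSum _ fun m _ => hJ τ m).const_mul _]
    refine Finset.sum_eq_zero fun τ hτ => ?_
    rw [integral_const_mul, integral_finsetSum _ fun m _ => hJ τ m]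
    simp only [integral_const_mul]
    rw [hg τ (Finset.ne_of_mem_erase hτ), mul_zero]
  rw [hR, Pi.sub_def] at hmono
  rw [integral_sub (hS.const_mul (1 - δ)) ((hI 0).const_mul (δ / 2)), integral_const_mul,
    integral_const_mul, integral_finsetSum _ fun τ _ => (hI τ).const_mul _] at hmono
  simp only [integral_const_mul] at hmono
  have hz : (0 : ι → ℕ) ∈ box ι α := by simp [mem_box]
  change ∑ τ ∈ box ι α, B τ ^ 2 * ∫ x, a x * ‖g τ x‖ ^ 2 ∂μ ≤ _
  rw [← Finset.add_sum_erase _ _ hz, hBz, one_pow, one_mul, ← div_eq_inv_mul,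
    le_div_iff₀ (by linarith)]
  have hpos : 0 ≤ ∫ x, a x * ‖g 0 x‖ ^ 2 ∂μ :=
    integral_nonneg fun x => mul_nonneg (ha x) (by positivity)
  -- Adding the term τ = 0 leaves the factor 1 - δ + δ/2 ≤ 1 in front of the energy of `g 0`.
  nlinarith

end Energy

/-! ### Gaussian integrals -/

section Gaussian

open ProbabilityTheory

/-- Completing the square on each half-line gives exp(c²/2) times γ[-c, ∞) + γ(-∞, c) = 1 + γ[-c,
c). The density is at most 1/√(2π), so γ[-c, c) ≤ 2c/√(2π), and 1 + s ≤ exp s. -/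
theorem lintegral_exp_mul_abs_gaussianReal_le {c : ℝ} (hc : 0 ≤ c) :
    ∫⁻ y, ENNReal.ofReal (Real.exp (c * |y|)) ∂(gaussianReal 0 1)
      ≤ ENNReal.ofReal (Real.exp (c ^ 2 / 2 + 2 * c / Real.sqrt (2 * Real.pi))) := by
  have hpdf : ∀ s y : ℝ, gaussianPDF s 1 y
      = ENNReal.ofReal ((Real.sqrt (2 * Real.pi))⁻¹ * Real.exp (-(y - s) ^ 2 / 2)) := fun s y => by
    simp [gaussianPDF, gaussianPDFReal]
  have hs0 : 0 < Real.sqrt (2 * Real.pi) := by positivity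
  have hshift : ∀ s y : ℝ, s ^ 2 = c ^ 2 → c * |y| = s * y →
      gaussianPDF 0 1 y * ENNReal.ofReal (Real.exp (c * |y|))
        = ENNReal.ofReal (Real.exp (c ^ 2 / 2)) * gaussianPDF s 1 y := fun s y hs hy => by
    rw [hpdf, hpdf, ← ENNReal.ofReal_mul (by positivity), ← ENNReal.ofReal_mul (by positivity),
      mul_left_comm, mul_assoc, ← Real.exp_add, ← Real.exp_add, hy]
    congr 3
    linear_combination hs / 2
  have hmeas : ∀ s, Measurable (gaussianPDF s 1) := fun s => measurable_gaussianPDF s 1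
  have hpos : ∫⁻ y in Ici 0, gaussianPDF 0 1 y * ENNReal.ofReal (Real.exp (c * |y|))
      = ENNReal.ofReal (Real.exp (c ^ 2 / 2)) * gaussianReal 0 1 (Ici (-c)) := by
    rw [setLIntegral_congr_fun measurableSet_Ici
      (fun y hy => hshift c y rfl (by rw [abs_of_nonneg hy])), lintegral_const_mul _ (hmeas c),
      ← gaussianReal_apply _ one_ne_zero, ← zero_add c, ← gaussianReal_map_add_const,
      Measure.map_apply (by fun_prop) measurableSet_Ici]
    congr 2
    ext y
    simp [neg_le_iff_add_nonneg]
  have hneg : ∫⁻ y in (Ici 0)ᶜ, gaussianPDF 0 1 y * ENNReal.ofReal (Real.exp (c * |y|))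
      = ENNReal.ofReal (Real.exp (c ^ 2 / 2)) * gaussianReal 0 1 (Iio c) := by
    rw [setLIntegral_congr_fun measurableSet_Ici.compl
      (fun y hy => hshift (-c) y (by ring) (by
        rw [abs_of_neg (by simpa using hy)]; ring)), lintegral_const_mul _ (hmeas _),
      ← gaussianReal_apply _ one_ne_zero, ← zero_add (-c), ← gaussianReal_map_add_const,
      Measure.map_apply (by fun_prop) measurableSet_Ici.compl]
    congr 2
    ext y
    simp [← sub_eq_add_neg]
  have hmid : gaussianReal 0 1 (Ico (-c) c) ≤ ENNReal.ofReal (2 * c / Real.sqrt (2 * Real.pi)) := by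
    rw [gaussianReal_apply _ one_ne_zero]
    calc ∫⁻ y in Ico (-c) c, gaussianPDF 0 1 y
        ≤ ∫⁻ _ in Ico (-c) c, ENNReal.ofReal (Real.sqrt (2 * Real.pi))⁻¹ := by
          refine lintegral_mono fun y => ?_
          rw [hpdf]
          refine ENNReal.ofReal_le_ofReal (mul_le_of_le_one_right (by positivity) ?_)
          rw [Real.exp_le_one_iff]
          nlinarith [sq_nonneg (y - 0)]
      _ = ENNReal.ofReal (2 * c / Real.sqrt (2 * Real.pi)) := by
          rw [lintegral_const, Measure.restrict_apply MeasurableSet.univ, univ_inter,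
            Real.volume_Ico, ← ENNReal.ofReal_mul (by positivity)]
          congr 1
          rw [div_eq_inv_mul]
          ring
  have hsum : gaussianReal 0 1 (Ici (-c)) + gaussianReal 0 1 (Iio c)
      ≤ 1 + ENNReal.ofReal (2 * c / Real.sqrt (2 * Real.pi)) := by
    have h1 : Iio c = Iio (-c) ∪ Ico (-c) c := (Iio_union_Ico_eq_Iio (by linarith)).symm
    have h2 : gaussianReal 0 1 (Ici (-c)) + gaussianReal 0 1 (Iio (-c)) = 1 := by
      rw [← compl_Ici, measure_add_measure_compl measurableSet_Ici, measure_univ]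
    calc gaussianReal 0 1 (Ici (-c)) + gaussianReal 0 1 (Iio c)
        ≤ gaussianReal 0 1 (Ici (-c))
            + (gaussianReal 0 1 (Iio (-c)) + gaussianReal 0 1 (Ico (-c) c)) := by
          rw [h1]
          gcongr
          exact measure_union_le _ _
      _ ≤ 1 + ENNReal.ofReal (2 * c / Real.sqrt (2 * Real.pi)) := by
          rw [← add_assoc, h2]
          gcongr
  rw [gaussianReal_of_var_ne_zero _ one_ne_zero, lintegral_withDensity_eq_lintegral_mul _ (hmeas 0)
    (by fun_prop)]
  simp only [Pi.mul_apply]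
  rw [← lintegral_add_compl _ (measurableSet_Ici (a := (0 : ℝ))), hpos, hneg, ← mul_add,
    Real.exp_add, ENNReal.ofReal_mul (by positivity)]
  gcongr
  refine hsum.trans ?_
  rw [← ENNReal.ofReal_one, ← ENNReal.ofReal_add zero_le_one (by positivity)]
  refine ENNReal.ofReal_le_ofReal ?_
  rw [add_comm]
  exact Real.add_one_le_exp _

variable {ι : Type*} [Fintype ι] [DecidableEq ι]

theorem lintegral_exp_sum_mul_abs_gaussian_le {c : ι → ℝ} (hc : ∀ i, 0 ≤ c i) :
    ∫⁻ y, ENNReal.ofReal (Real.exp (∑ i, c i * |y i|)) ∂(gaussian ι)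
      ≤ ENNReal.ofReal
          (Real.exp (∑ i, (c i ^ 2 / 2 + 2 * c i / Real.sqrt (2 * Real.pi)))) := by
  have hind : iIndepFun (fun (i : ι) (y : ι → ℝ) => ENNReal.ofReal (Real.exp (c i * |y i|)))
      (gaussian ι) :=
    iIndepFun_pi (μ := fun _ : ι => gaussianReal 0 1)
      (X := fun i t => ENNReal.ofReal (Real.exp (c i * |t|))) (fun i => by fun_prop)
  simp only [Real.exp_sum, ENNReal.ofReal_prod_of_nonneg fun i _ => (Real.exp_pos _).le]
  rw [lintegral_prod_eq_prod_lintegral_of_indepFun _ _ hind (fun i => by fun_prop)]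
  refine Finset.prod_le_prod' fun i _ => ?_
  refine le_trans (le_of_eq ?_) (lintegral_exp_mul_abs_gaussianReal_le (hc i))
  exact (measurePreserving_eval (fun _ : ι => gaussianReal 0 1) i).lintegral_comp
    (f := fun t => ENNReal.ofReal (Real.exp (c i * |t|))) (by fun_prop)

/-- Marginals of the product Gaussian are Gaussian. This brings the integrals in the norm, taken
over different coordinate sets, to one common space. -/
theorem lintegral_gaussian_subtype (p : ι → Prop) [DecidablePred p] {h : (ι → ℝ) → ℝ≥0∞}
    (hh : Measurable h) :
    ∫⁻ z, h (glue p z 0) ∂(gaussian {i // p i})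
      = ∫⁻ y, h (fun i => if p i then y i else 0) ∂(gaussian ι) := by
  have hm : Measurable fun z : {i // p i} → ℝ => h (glue p z 0) := by
    refine hh.comp (measurable_pi_lambda _ fun i => ?_)
    unfold glue
    split_ifs with hi
    · exact measurable_pi_apply _
    · exact measurable_const
  have h1 := measurePreserving_piEquivPiSubtypeProd (fun _ : ι => gaussianReal 0 1) p
  have h2 := measurePreserving_fst.comp h1
  have h3 := h2.lintegral_comp hm
  exact h3.symm

end Gaussian

/-! ### Weighted bilinear forms on `L²` -/

section Form

variable {X : Type*} [MeasurableSpace X] {μ : Measure X}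
  {H : Type*} [NormedAddCommGroup H] [InnerProductSpace ℝ H]
  {W : Type*} [NormedAddCommGroup W] [InnerProductSpace ℝ W]

section Compact

variable {Q : Type*} [TopologicalSpace Q] [CompactSpace Q] [MeasurableSpace Q]
  [OpensMeasurableSpace Q]

theorem memLp_top_comp {θ : X → Q} (hθ : AEMeasurable θ μ) (c : C(Q, ℝ)) :
    MemLp (fun x => c (θ x)) ∞ μ :=
  memLp_top_of_bound (c.continuous.measurable.comp_aemeasurable hθ).aestronglyMeasurable ‖c‖
    (Filter.Eventually.of_forall fun x => c.norm_coe_le_norm (θ x))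

theorem integrable_comp_mul_inner {θ : X → Q} (hθ : AEMeasurable θ μ) (c : C(Q, ℝ))
    (g h : Lp H 2 μ) : Integrable (fun x => c (θ x) * ⟪g x, h x⟫) μ :=
  (L2.integrable_inner (𝕜 := ℝ) g h).bdd_mul
    (c.continuous.measurable.comp_aemeasurable hθ).aestronglyMeasurable
    (Filter.Eventually.of_forall fun x => c.norm_coe_le_norm (θ x))

/-- Multiplication by c ∘ θ is a bounded operator on L², linear in c, by Hölder between L^∞ and L².
-/
theorem exists_clm_form {θ : X → Q} (hθ : AEMeasurable θ μ) (J : W →L[ℝ] Lp H 2 μ) :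
    ∃ T : C(Q, ℝ) →L[ℝ] W →L[ℝ] StrongDual ℝ W,
      ∀ c v w, T c v w = ∫ x, c (θ x) * ⟪J v x, J w x⟫ ∂μ := by
  let L0 : C(Q, ℝ) →ₗ[ℝ] Lp ℝ ∞ μ :=
    { toFun := fun c => (memLp_top_comp hθ c).toLp _
      map_add' := fun c c' => MemLp.toLp_add (memLp_top_comp hθ c) (memLp_top_comp hθ c')
      map_smul' := fun r c => MemLp.toLp_const_smul r (memLp_top_comp hθ c) }
  let L1 : C(Q, ℝ) →L[ℝ] Lp ℝ ∞ μ := L0.mkContinuous 1 fun c => by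
    rw [one_mul]
    refine (Lp.norm_toLp _ (memLp_top_comp hθ c)).trans_le
      (ENNReal.toReal_le_of_le_ofReal (norm_nonneg c) ?_)
    rw [eLpNorm_exponent_top]
    exact eLpNormEssSup_le_of_ae_bound
      (Filter.Eventually.of_forall fun x => c.norm_coe_le_norm (θ x))
  let M : C(Q, ℝ) →L[ℝ] Lp H 2 μ →L[ℝ] Lp H 2 μ :=
    ((ContinuousLinearMap.lsmul ℝ ℝ : ℝ →L[ℝ] H →L[ℝ] H).holderL μ ∞ 2 2).comp L1
  have hM : ∀ c g, M c g =ᵐ[μ] fun x => c (θ x) • g x := fun c g => by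
    have h1 := (ContinuousLinearMap.lsmul ℝ ℝ : ℝ →L[ℝ] H →L[ℝ] H).coeFn_holder (r := 2)
      (L1 c) g
    filter_upwards [h1, (memLp_top_comp hθ c).coeFn_toLp] with x hx hx'
    refine hx.trans ?_
    change (L1 c) x = _ at hx'
    simp [hx']
  let P : (Lp H 2 μ) →L[ℝ] StrongDual ℝ W :=
    (ContinuousLinearMap.precomp ℝ J).comp (innerSL ℝ)
  refine ⟨((ContinuousLinearMap.compL ℝ W (Lp H 2 μ) (StrongDual ℝ W)).flip J).comp
    ((ContinuousLinearMap.compL ℝ (Lp H 2 μ) (Lp H 2 μ) (StrongDual ℝ W) P).comp M),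
    fun c v w => ?_⟩
  have h2 : ⟪M c (J v), J w⟫ = ∫ x, c (θ x) * ⟪J v x, J w x⟫ ∂μ := by
    rw [L2.inner_def]
    refine integral_congr_ae ?_
    filter_upwards [hM c (J v)] with x hx
    rw [hx, real_inner_smul_left]
  exact h2

end Compact

theorem expCoeff_continuousMap_apply {ι : Type*} [Fintype ι] {Q : Type*} [TopologicalSpace Q]
    [CompactSpace Q] (P : ι → C(Q, ℝ)) (y : ι → ℝ) (q : Q) :
    expCoeff P y q = Real.exp (∑ i, y i * P i q) := by
  let _ : NormedAlgebra ℚ C(Q, ℝ) := NormedAlgebra.restrictScalars ℚ ℝ _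
  have h := NormedSpace.map_exp (ContinuousMap.evalAlgHom ℝ ℝ q)
    (continuous_eval_const q) (∑ i, y i • P i)
  rw [Real.exp_eq_exp_ℝ]
  simpa [expCoeff] using h

variable {ι : Type*} [Fintype ι] [DecidableEq ι]

/-- The compact cube in which the functions `φ_j` take their values. -/
abbrev Cube (K : ι → ℝ) : Type _ := ∀ i, Icc (-K i) (K i)

/-- The coordinate functions on a cube. -/
def cubeCoord (K : ι → ℝ) (i : ι) : C(Cube K, ℝ) := ⟨fun q => q i, by fun_prop⟩

theorem exists_cube_map {φ : ι → X → ℝ} (hφ : ∀ i, AEMeasurable (φ i) μ) {K : ι → ℝ}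
    (hK0 : ∀ i, 0 ≤ K i) (hK : ∀ᵐ x ∂μ, ∀ i, |φ i x| ≤ K i) :
    ∃ θ : X → Cube K, AEMeasurable θ μ ∧ ∀ᵐ x ∂μ, ∀ (n : ι → ℕ) (y : ι → ℝ),
      ((∏ i, cubeCoord K i ^ n i) * expCoeff (cubeCoord K) y) (θ x)
        = (∏ i, φ i x ^ n i) * Real.exp (∑ i, y i * φ i x) := by
  have hle : ∀ i, -K i ≤ K i := fun i => by linarith [hK0 i]
  -- Clamping defines θ everywhere; it changes φ only on the null set where the bound fails.
  refine ⟨fun x i => projIcc (-K i) (K i) (hle i) (φ i x), aemeasurable_pi_iff.mpr fun i =>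
    (continuous_projIcc.measurable).comp_aemeasurable (hφ i), ?_⟩
  filter_upwards [hK] with x hx n y
  have h1 : ∀ i, cubeCoord K i (fun i => projIcc (-K i) (K i) (hle i) (φ i x)) = φ i x :=
    fun i => by
      change ((projIcc (-K i) (K i) (hle i) (φ i x) : Icc (-K i) (K i)) : ℝ) = φ i x
      rw [projIcc_of_mem _ (abs_le.mp (hx i))]
  rw [ContinuousMap.mul_apply, expCoeff_continuousMap_apply, ContinuousMap.prod_apply]
  simp only [ContinuousMap.pow_apply, h1]

end Form

/-! ### The weighted variational equation -/

section Variational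

variable {X : Type*} [MeasurableSpace X] {μ : Measure X}
  {H : Type*} [NormedAddCommGroup H] [InnerProductSpace ℝ H]
  {W : Type*} [NormedAddCommGroup W] [InnerProductSpace ℝ W]
  {ι : Type*} [Fintype ι] [DecidableEq ι]

/-- The weight `exp (∑ y_i φ_i)`. -/
def weight (φ : ι → X → ℝ) (y : ι → ℝ) (x : X) : ℝ := Real.exp (∑ i, y i * φ i x)

variable {φ : ι → X → ℝ} {b : ι → ℝ} {κ : ℝ}

theorem ae_abs_le_mul (hb : ∀ i, 0 < b i) (hκ : ∀ᵐ x ∂μ, ∑ i, |φ i x| / b i ≤ κ) :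
    ∀ᵐ x ∂μ, ∀ i, |φ i x| ≤ κ * b i := by
  filter_upwards [hκ] with x hx i
  rw [← div_le_iff₀ (hb i)]
  exact (Finset.single_le_sum (f := fun i => |φ i x| / b i)
    (fun i _ => div_nonneg (abs_nonneg _) (hb i).le) (Finset.mem_univ i)).trans hx

theorem ae_le_weight (hb : ∀ i, 0 < b i) (hκ : ∀ᵐ x ∂μ, ∑ i, |φ i x| / b i ≤ κ) (y : ι → ℝ) :
    ∀ᵐ x ∂μ, Real.exp (-∑ i, κ * b i * |y i|) ≤ weight φ y x := by
  filter_upwards [ae_abs_le_mul hb hκ] with x hx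
  refine Real.exp_le_exp.mpr ?_
  rw [← Finset.sum_neg_distrib]
  refine Finset.sum_le_sum fun i _ => ?_
  refine le_trans ?_ (neg_abs_le _)
  rw [abs_mul, mul_comm |y i|]
  exact neg_le_neg (mul_le_mul_of_nonneg_right (hx i) (abs_nonneg _))

theorem exists_form (hφ : ∀ i, AEMeasurable (φ i) μ) (hb : ∀ i, 0 < b i) (hκ0 : 0 ≤ κ)
    (hκ : ∀ᵐ x ∂μ, ∑ i, |φ i x| / b i ≤ κ) (J : W →L[ℝ] Lp H 2 μ) :
    ∃ T : C(Cube fun i => κ * b i, ℝ) →L[ℝ] W →L[ℝ] StrongDual ℝ W,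
      ∀ (n : ι → ℕ) (y : ι → ℝ) (v w : W),
        T ((∏ i, cubeCoord _ i ^ n i) * expCoeff (cubeCoord _) y) v w
          = ∫ x, ((∏ i, φ i x ^ n i) * weight φ y x) * ⟪J v x, J w x⟫ ∂μ := by
  obtain ⟨θ, hθ, h⟩ := exists_cube_map hφ (K := fun i => κ * b i)
    (fun i => mul_nonneg hκ0 (hb i).le) (ae_abs_le_mul hb hκ)
  obtain ⟨T, hT⟩ := exists_clm_form hθ J
  refine ⟨T, fun n y v w => ?_⟩
  rw [hT]
  refine integral_congr_ae ?_
  filter_upwards [h] with x hx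
  rw [hx]
  rfl

theorem integrable_weight_mul_inner (hφ : ∀ i, AEMeasurable (φ i) μ) (hb : ∀ i, 0 < b i)
    (hκ0 : 0 ≤ κ) (hκ : ∀ᵐ x ∂μ, ∑ i, |φ i x| / b i ≤ κ) (n : ι → ℕ) (y : ι → ℝ)
    (g h : Lp H 2 μ) :
    Integrable (fun x => ((∏ i, φ i x ^ n i) * weight φ y x) * ⟪g x, h x⟫) μ := by
  obtain ⟨θ, hθ, hc⟩ := exists_cube_map hφ (K := fun i => κ * b i)
    (fun i => mul_nonneg hκ0 (hb i).le) (ae_abs_le_mul hb hκ)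
  refine (integrable_comp_mul_inner hθ ((∏ i, cubeCoord _ i ^ n i) * expCoeff (cubeCoord _) y)
    g h).congr ?_
  filter_upwards [hc] with x hx
  rw [hx n y]
  rfl

theorem mul_norm_sq_le_integral (hφ : ∀ i, AEMeasurable (φ i) μ) (hb : ∀ i, 0 < b i)
    (hκ0 : 0 ≤ κ) (hκ : ∀ᵐ x ∂μ, ∑ i, |φ i x| / b i ≤ κ) (y : ι → ℝ) (g : Lp H 2 μ) :
    Real.exp (-∑ i, κ * b i * |y i|) * ‖g‖ ^ 2 ≤ ∫ x, weight φ y x * ‖g x‖ ^ 2 ∂μ := by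
  rw [← real_inner_self_eq_norm_sq, L2.inner_def, ← integral_const_mul]
  refine integral_mono_ae ((L2.integrable_inner g g).const_mul _) ?_ ?_
  · simpa using integrable_weight_mul_inner hφ hb hκ0 hκ 0 y g g
  · filter_upwards [ae_le_weight hb hκ y] with x hx
    rw [real_inner_self_eq_norm_sq]
    exact mul_le_mul_of_nonneg_right hx (by positivity)

variable [CompleteSpace W]

/-- Lax–Milgram. The coercivity constant depends on y, which suffices for invertibility at each y.
-/
theorem exists_equiv_of_form (hφ : ∀ i, AEMeasurable (φ i) μ) (hb : ∀ i, 0 < b i) (hκ0 : 0 ≤ κ)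
    (hκ : ∀ᵐ x ∂μ, ∑ i, |φ i x| / b i ≤ κ) (J : W →ₗᵢ[ℝ] Lp H 2 μ) (y : ι → ℝ)
    (B : W →L[ℝ] StrongDual ℝ W)
    (hB : ∀ v w, B v w = ∫ x, weight φ y x * ⟪J v x, J w x⟫ ∂μ) :
    ∃ e : W ≃L[ℝ] StrongDual ℝ W, (e : W →L[ℝ] StrongDual ℝ W) = B := by
  have hco : IsCoercive B := by
    refine ⟨Real.exp (-∑ i, κ * b i * |y i|), Real.exp_pos _, fun v => ?_⟩
    rw [hB, mul_assoc, ← sq, ← J.norm_map v]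
    simpa using mul_norm_sq_le_integral hφ hb hκ0 hκ y (J v)
  refine ⟨hco.continuousLinearEquivOfBilin.trans
    (InnerProductSpace.toDual ℝ W).toContinuousLinearEquiv, ?_⟩
  ext v w
  exact hco.continuousLinearEquivOfBilin_apply v w

theorem existsUnique_weighted (hφ : ∀ i, AEMeasurable (φ i) μ) (hb : ∀ i, 0 < b i) (hκ0 : 0 ≤ κ)
    (hκ : ∀ᵐ x ∂μ, ∑ i, |φ i x| / b i ≤ κ) (J : W →ₗᵢ[ℝ] Lp H 2 μ) (F : StrongDual ℝ W)
    (y : ι → ℝ) :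
    ∃! u : W, ∀ w, ∫ x, weight φ y x * ⟪J u x, J w x⟫ ∂μ = F w := by
  obtain ⟨T, hT⟩ := exists_form hφ hb hκ0 hκ J.toContinuousLinearMap
  have hB : ∀ v w, T (expCoeff (cubeCoord _) y) v w
      = ∫ x, weight φ y x * ⟪J v x, J w x⟫ ∂μ := fun v w => by simpa using hT 0 y v w
  obtain ⟨e, he⟩ := exists_equiv_of_form hφ hb hκ0 hκ J y _ hB
  simp only [← hB, ← he]
  refine ⟨e.symm F, fun w => by simp, fun u hu => ?_⟩
  rw [ContinuousLinearEquiv.eq_symm_apply]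
  ext w
  exact hu w

/-- Test with u itself: the energy equals F u ≤ ‖F‖ ‖u‖, and the lower bound of the weight turns it
into a bound on ‖u‖. -/
theorem weighted_energy_le (hφ : ∀ i, AEMeasurable (φ i) μ) (hb : ∀ i, 0 < b i) (hκ0 : 0 ≤ κ)
    (hκ : ∀ᵐ x ∂μ, ∑ i, |φ i x| / b i ≤ κ) (J : W →ₗᵢ[ℝ] Lp H 2 μ) {F : StrongDual ℝ W}
    {y : ι → ℝ} {u : W} (hu : ∀ w, ∫ x, weight φ y x * ⟪J u x, J w x⟫ ∂μ = F w) :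
    ‖u‖ ≤ ‖F‖ * Real.exp (∑ i, κ * b i * |y i|) ∧
      ∫ x, weight φ y x * ‖J u x‖ ^ 2 ∂μ ≤ ‖F‖ ^ 2 * Real.exp (∑ i, κ * b i * |y i|) := by
  have h1 : ∫ x, weight φ y x * ‖J u x‖ ^ 2 ∂μ = F u := by simpa using hu u
  have h2 := mul_norm_sq_le_integral hφ hb hκ0 hκ y (J u)
  have h3 : F u ≤ ‖F‖ * ‖u‖ := (le_abs_self _).trans (F.le_opNorm u)
  rw [h1, J.norm_map, Real.exp_neg, inv_mul_le_iff₀ (Real.exp_pos _)] at h2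
  rw [h1]
  set r := Real.exp (∑ i, κ * b i * |y i|)
  have hr : 0 < r := Real.exp_pos _
  have h4 : ‖u‖ ≤ ‖F‖ * r := by
    rcases (norm_nonneg u).eq_or_lt with h0 | h0
    · rw [← h0]
      positivity
    · refine le_of_mul_le_mul_right ?_ h0
      nlinarith [mul_le_mul_of_nonneg_left h3 hr.le]
  exact ⟨h4, by nlinarith [mul_le_mul_of_nonneg_left h4 (norm_nonneg F)]⟩

/-- The parametric solution is smooth, with a summed bound for its mixed derivatives of order at
least one in each parameter. -/
theorem exists_family_weighted (hφ : ∀ i, AEMeasurable (φ i) μ) (hb : ∀ i, 0 < b i ∧ b i ≤ 1)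
    (hκ0 : 0 ≤ κ) (hκ : ∀ᵐ x ∂μ, ∑ i, |φ i x| / b i ≤ κ) (J : W →ₗᵢ[ℝ] Lp H 2 μ)
    {F : StrongDual ℝ W} {U : (ι → ℝ) → W}
    (hU : ∀ y w, ∫ x, weight φ y x * ⟪J (U y) x, J w x⟫ ∂μ = F w) :
    ∃ D, IsSmoothFamily U D ∧ ∀ (α : ℕ) (δ : ℝ), 0 ≤ δ → δ < 1 → α * κ ≤ δ * Real.log 2 →
      ∀ y, ∑ τ ∈ Fintype.piFinset fun _ : ι => Finset.Icc 1 α, ‖D τ y‖ ^ 2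
        ≤ (∏ i, b i) ^ 2 * (1 - δ)⁻¹ * ‖F‖ ^ 2 * Real.exp (2 * ∑ i, κ * b i * |y i|) := by
  have hb0 : ∀ i, 0 < b i := fun i => (hb i).1
  obtain ⟨T, hT⟩ := exists_form hφ hb0 hκ0 hκ J.toContinuousLinearMap
  have hB : ∀ y v w, T (expCoeff (cubeCoord _) y) v w
      = ∫ x, weight φ y x * ⟪J v x, J w x⟫ ∂μ := fun y v w => by simpa using hT 0 y v w
  have hTU : ∀ y, T (expCoeff (cubeCoord _) y) (U y) = F := fun y => by
    ext w
    rw [hB, hU]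
  have hsm := contDiff_of_apply_eq
    (fun y => exists_equiv_of_form hφ hb0 hκ0 hκ J y _ (hB y)) hTU
  obtain ⟨D, hD⟩ := exists_isSmoothFamily hsm
  refine ⟨D, hD, fun α δ h0 h1 hδ y => ?_⟩
  have hen := energy_estimate (μ := μ) (φ := φ) (a := weight φ y) (g := fun τ => J (D τ y))
    (α := α) hb0 h0 h1 (by
      filter_upwards [hκ] with x hx
      refine le_trans (mul_le_mul_of_nonneg_left ?_ (Nat.cast_nonneg α)) hδ
      refine le_trans (le_of_eq (Finset.sum_congr rfl fun i _ => ?_)) hx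
      rw [abs_div, abs_of_pos (hb0 i)])
    (fun x => (Real.exp_pos _).le)
    (fun n m τ => integrable_weight_mul_inner hφ hb0 hκ0 hκ n y _ _)
    (fun τ hτ => by
      have h2 := congrArg (fun G : StrongDual ℝ W => G (D τ y)) (leibniz_of_apply_eq hTU hD τ y)
      simp only [if_neg hτ, sum_apply, smul_apply,
        zero_apply, hT, nsmul_eq_mul] at h2
      exact h2)
  have hz := (weighted_energy_le hφ hb0 hκ0 hκ J (hU y)).2
  simp only [hD.zero] at hen
  set r := Real.exp (∑ i, κ * b i * |y i|) with hr
  have hrpos : 0 < r := Real.exp_pos _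
  have hrr : Real.exp (2 * ∑ i, κ * b i * |y i|) = r * r := by rw [two_mul, Real.exp_add]
  have hbp : 0 < ∏ i, b i := Finset.prod_pos fun i _ => hb0 i
  have hδ' : 0 < 1 - δ := by linarith
  -- The factor r undoes the weight, and b^τ ≤ ∏ b_i since b_i ≤ 1 and every τ_i ≥ 1.
  have hterm : ∀ τ ∈ Fintype.piFinset fun _ : ι => Finset.Icc 1 α,
      ‖D τ y‖ ^ 2 ≤ (∏ i, b i) ^ 2 * r *
        (((∏ i, b i ^ τ i)⁻¹) ^ 2 * ∫ x, weight φ y x * ‖J (D τ y) x‖ ^ 2 ∂μ) := by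
    intro τ hτ
    have h3 := mul_norm_sq_le_integral hφ hb0 hκ0 hκ y (J (D τ y))
    rw [J.norm_map, Real.exp_neg, inv_mul_le_iff₀ hrpos] at h3
    have h4 : ∏ i, b i ^ τ i ≤ ∏ i, b i := Finset.prod_le_prod (fun i _ => pow_nonneg (hb0 i).le _)
      fun i _ => by
        have h5 := (Finset.mem_Icc.mp (Fintype.mem_piFinset.mp hτ i)).1
        simpa using pow_le_pow_of_le_one (hb0 i).le (hb i).2 h5
    have h6 : 0 < ∏ i, b i ^ τ i := Finset.prod_pos fun i _ => pow_pos (hb0 i) _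
    have h7 : 1 ≤ (∏ i, b i) ^ 2 * ((∏ i, b i ^ τ i)⁻¹) ^ 2 := by
      rw [← mul_pow]
      refine one_le_pow₀ ?_
      rw [← div_eq_mul_inv, one_le_div h6]
      exact h4
    have h8 : 0 ≤ r * ∫ x, weight φ y x * ‖J (D τ y) x‖ ^ 2 ∂μ :=
      le_trans (by positivity) h3
    nlinarith [mul_le_mul_of_nonneg_right h7 h8]
  have hsub : (Fintype.piFinset fun _ : ι => Finset.Icc 1 α) ⊆ box ι α := fun τ hτ =>
    mem_box.mpr fun i => (Finset.mem_Icc.mp (Fintype.mem_piFinset.mp hτ i)).2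
  calc ∑ τ ∈ Fintype.piFinset fun _ : ι => Finset.Icc 1 α, ‖D τ y‖ ^ 2
      ≤ ∑ τ ∈ Fintype.piFinset fun _ : ι => Finset.Icc 1 α, (∏ i, b i) ^ 2 * r *
        (((∏ i, b i ^ τ i)⁻¹) ^ 2 * ∫ x, weight φ y x * ‖J (D τ y) x‖ ^ 2 ∂μ) :=
        Finset.sum_le_sum hterm
    _ ≤ ∑ τ ∈ box ι α, (∏ i, b i) ^ 2 * r *
        (((∏ i, b i ^ τ i)⁻¹) ^ 2 * ∫ x, weight φ y x * ‖J (D τ y) x‖ ^ 2 ∂μ) := by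
        refine Finset.sum_le_sum_of_subset_of_nonneg hsub fun τ _ _ => ?_
        refine mul_nonneg (by positivity) (mul_nonneg (by positivity) ?_)
        exact integral_nonneg fun x => mul_nonneg (Real.exp_pos _).le (by positivity)
    _ ≤ (∏ i, b i) ^ 2 * r * ((1 - δ)⁻¹ * (‖F‖ ^ 2 * r)) := by
        rw [← Finset.mul_sum]
        refine mul_le_mul_of_nonneg_left (hen.trans ?_) (by positivity)
        exact mul_le_mul_of_nonneg_left hz (by positivity)
    _ = _ := by
        rw [hrr]
        ring

end Variational

/-! ### Anchored combinations and their norms -/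

section Anchored

variable {ι : Type*} [Fintype ι] [DecidableEq ι] {E : Type*} [NormedAddCommGroup E]
  [NormedSpace ℝ E]

/-- The projection setting the coordinates outside `p` to zero. -/
def coordProj (p : ι → Prop) [DecidablePred p] (y : ι → ℝ) : ι → ℝ :=
  fun i => if p i then y i else 0

theorem continuous_coordProj (p : ι → Prop) [DecidablePred p] : Continuous (coordProj p) := by
  refine continuous_pi fun i => ?_
  unfold coordProj
  split_ifs
  · exact continuous_apply i
  · exact continuous_const

theorem abs_coordProj_le (p : ι → Prop) [DecidablePred p] (y : ι → ℝ) (i : ι) :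
    |coordProj p y i| ≤ |y i| := by
  unfold coordProj
  split_ifs <;> simp

theorem exp_sum_coordProj_le (p : ι → Prop) [DecidablePred p] {c : ι → ℝ} (hc : ∀ i, 0 ≤ c i)
    (y : ι → ℝ) :
    Real.exp (∑ i, c i * |coordProj p y i|) ≤ Real.exp (∑ i, c i * |y i|) :=
  Real.exp_le_exp.mpr <| Finset.sum_le_sum fun i _ =>
    mul_le_mul_of_nonneg_left (abs_coordProj_le p y i) (hc i)

/-- A function of the projected variable is constant in each frozen direction, so any derivative
involving one vanishes. -/
theorem IsSmoothFamily.comp_coordProj {F : (ι → ℝ) → E} {D : (ι → ℕ) → (ι → ℝ) → E}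
    (hD : IsSmoothFamily F D) (p : ι → Prop) [DecidablePred p] :
    IsSmoothFamily (fun y => F (coordProj p y))
      (fun τ y => if ∀ i, τ i ≠ 0 → p i then D τ (coordProj p y) else 0) where
  zero := by simp [hD.zero]
  continuous τ := by
    split_ifs
    · exact (hD.continuous τ).comp (continuous_coordProj p)
    · exact continuous_const
  hasDerivAt τ j y := by
    by_cases hτ : ∀ i, τ i ≠ 0 → p i
    · simp only [if_pos hτ]
      by_cases hj : p j
      · have h1 : ∀ i, (τ + Pi.single j 1 : ι → ℕ) i ≠ 0 → p i := fun i hi => by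
          by_cases h : i = j
          · exact h ▸ hj
          · exact hτ i (by simpa [h] using hi)
        have h2 : ∀ t, coordProj p (Function.update y j t)
            = Function.update (coordProj p y) j t := fun t => by
          funext i
          by_cases h : i = j
          · subst h; simp [coordProj, hj]
          · simp [coordProj, h]
        rw [if_pos h1]
        simp only [h2]
        have h3 := hD.hasDerivAt τ j (coordProj p y)
        simpa [coordProj, hj] using h3
      · have h1 : ¬ ∀ i, (τ + Pi.single j 1 : ι → ℕ) i ≠ 0 → p i := fun h => hj (h j (by simp))
        have h2 : ∀ t, coordProj p (Function.update y j t) = coordProj p y := fun t => by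
          funext i
          by_cases h : i = j
          · subst h; simp [coordProj, hj]
          · simp [coordProj, h]
        rw [if_neg h1]
        simp only [h2]
        exact hasDerivAt_const _ _
    · have h1 : ¬ ∀ i, (τ + Pi.single j 1 : ι → ℕ) i ≠ 0 → p i := fun h =>
        hτ fun i hi => h i (by simp [hi])
      simp only [if_neg hτ, if_neg h1]
      exact hasDerivAt_const _ _

theorem IsSmoothFamily.sum_smul {σ : Type*} (s : Finset σ) (c : σ → ℝ)
    {F : σ → (ι → ℝ) → E} {D : σ → (ι → ℕ) → (ι → ℝ) → E}
    (hD : ∀ k ∈ s, IsSmoothFamily (F k) (D k)) :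
    IsSmoothFamily (fun y => ∑ k ∈ s, c k • F k y) (fun τ y => ∑ k ∈ s, c k • D k τ y) where
  zero := by
    funext y
    exact Finset.sum_congr rfl fun k hk => by rw [(hD k hk).zero]
  continuous τ := continuous_finsetSum _ fun k hk => ((hD k hk).continuous τ).const_smul _
  hasDerivAt τ j y := HasDerivAt.fun_sum fun k hk =>
    ((hD k hk).hasDerivAt τ j y).const_smul (c k)

/-- The Gaussian bound with 2c: the exponent (2c)²/2 + 4c/√(2π) is twice c² + 2c/√(2π), hence the
perfect square. -/
theorem lintegral_ofReal_sq_exp_le {c : ι → ℝ} (hc : ∀ i, 0 ≤ c i) (M : ℝ) :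
    ∫⁻ y, ENNReal.ofReal (M ^ 2 * Real.exp (2 * ∑ i, c i * |y i|)) ∂(gaussian ι)
      ≤ ENNReal.ofReal
        ((M * Real.exp (∑ i, (c i ^ 2 + 2 * c i / Real.sqrt (2 * Real.pi)))) ^ 2) := by
  have h1 := lintegral_exp_sum_mul_abs_gaussian_le (c := fun i => 2 * c i)
    (fun i => mul_nonneg zero_le_two (hc i))
  have h2 : ∀ y : ι → ℝ, 2 * ∑ i, c i * |y i| = ∑ i, 2 * c i * |y i| := fun y => by
    rw [Finset.mul_sum]
    exact Finset.sum_congr rfl fun i _ => by ring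
  simp only [h2, ENNReal.ofReal_mul (sq_nonneg M)]
  rw [lintegral_const_mul' _ _ ENNReal.ofReal_ne_top, mul_pow, ENNReal.ofReal_mul (sq_nonneg M)]
  refine mul_le_mul_right (h1.trans (ENNReal.ofReal_le_ofReal (le_of_eq ?_))) _
  rw [← Real.exp_nat_mul, Finset.mul_sum]
  congr 1
  refine Finset.sum_congr rfl fun i _ => ?_
  push_cast
  ring

theorem integrable_of_norm_le_exp {F : (ι → ℝ) → E} (hF : Continuous F) {c : ι → ℝ}
    (hc : ∀ i, 0 ≤ c i) {M : ℝ} (hM : 0 ≤ M)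
    (h : ∀ y, ‖F y‖ ≤ M * Real.exp (∑ i, c i * |y i|)) : Integrable F (gaussian ι) := by
  refine ⟨hF.aestronglyMeasurable, ?_⟩
  refine lt_of_le_of_lt (lintegral_mono fun y => ?_)
    (lt_of_le_of_lt (lintegral_ofReal_sq_exp_le (c := fun i => c i / 2)
      (fun i => div_nonneg (hc i) zero_le_two) (Real.sqrt M)) ENNReal.ofReal_lt_top)
  rw [← ofReal_norm, Real.sq_sqrt hM, Finset.mul_sum]
  refine ENNReal.ofReal_le_ofReal ((h y).trans (le_of_eq ?_))
  congr 2
  exact Finset.sum_congr rfl fun i _ => by ring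

/-- For a fixed set v of top-order coordinates, all τ are evaluated at the same projected point, so
`hsum` bounds their sum there, and projecting only decreases the exponential. Summing over the
subsets v costs 2^card. -/
theorem normOfFamily_le {α : ℕ} {D : (ι → ℕ) → (ι → ℝ) → E} (hD : ∀ τ, Continuous (D τ))
    {c : ι → ℝ} (hc : ∀ i, 0 ≤ c i) {M : ℝ} (hM : 0 ≤ M)
    (hsum : ∀ y, ∑ τ ∈ Fintype.piFinset fun _ : ι => Finset.Icc 1 α, ‖D τ y‖ ^ 2
      ≤ M ^ 2 * Real.exp (2 * ∑ i, c i * |y i|)) :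
    normOfFamily α D ≤ ENNReal.ofReal (M * 2 ^ ((Fintype.card ι : ℝ) / 2) *
      Real.exp (∑ i, (c i ^ 2 + 2 * c i / Real.sqrt (2 * Real.pi)))) := by
  set S := Fintype.piFinset fun _ : ι => Finset.Icc 1 α with hS
  have hpt : ∀ y : ι → ℝ, ∑ τ ∈ S, ‖D τ (coordProj (fun i => τ i = α) y)‖ₑ ^ 2
      ≤ 2 ^ Fintype.card ι * ENNReal.ofReal (M ^ 2 * Real.exp (2 * ∑ i, c i * |y i|)) := by
    intro y
    have h1 : ∀ τ, ‖D τ (coordProj (fun i => τ i = α) y)‖ₑ ^ 2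
        = ENNReal.ofReal (‖D τ (coordProj (fun i => τ i = α) y)‖ ^ 2) := fun τ => by
      rw [ENNReal.ofReal_pow (norm_nonneg _), ofReal_norm]
    simp only [h1]
    rw [← ENNReal.ofReal_sum_of_nonneg fun _ _ => by positivity]
    have h2 : (2 : ℝ≥0∞) ^ Fintype.card ι = ENNReal.ofReal (2 ^ Fintype.card ι) := by
      rw [ENNReal.ofReal_pow zero_le_two, ENNReal.ofReal_ofNat]
    rw [h2, ← ENNReal.ofReal_mul (by positivity)]
    refine ENNReal.ofReal_le_ofReal ?_
    calc ∑ τ ∈ S, ‖D τ (coordProj (fun i => τ i = α) y)‖ ^ 2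
        = ∑ v ∈ (Finset.univ : Finset ι).powerset,
            ∑ τ ∈ S with Finset.univ.filter (fun i => τ i = α) = v,
              ‖D τ (coordProj (fun i => τ i = α) y)‖ ^ 2 :=
          (Finset.sum_fiberwise_of_maps_to (fun τ _ => by simp) _).symm
      _ ≤ ∑ v ∈ (Finset.univ : Finset ι).powerset, M ^ 2 * Real.exp (2 * ∑ i, c i * |y i|) := by
          refine Finset.sum_le_sum fun v _ => ?_
          calc ∑ τ ∈ S with Finset.univ.filter (fun i => τ i = α) = v,
                ‖D τ (coordProj (fun i => τ i = α) y)‖ ^ 2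
              = ∑ τ ∈ S with Finset.univ.filter (fun i => τ i = α) = v,
                ‖D τ (coordProj (fun i => i ∈ v) y)‖ ^ 2 := by
                refine Finset.sum_congr rfl fun τ hτ => ?_
                have h3 := (Finset.mem_filter.mp hτ).2
                congr 3
                funext i
                simp [coordProj, ← h3]
            _ ≤ ∑ τ ∈ S, ‖D τ (coordProj (fun i => i ∈ v) y)‖ ^ 2 :=
                Finset.sum_le_sum_of_subset_of_nonneg (Finset.filter_subset _ _)
                  fun _ _ _ => by positivity
            _ ≤ M ^ 2 * Real.exp (2 * ∑ i, c i * |coordProj (fun i => i ∈ v) y i|) := hsum _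
            _ ≤ M ^ 2 * Real.exp (2 * ∑ i, c i * |y i|) := by
                refine mul_le_mul_of_nonneg_left (Real.exp_le_exp.mpr ?_) (sq_nonneg M)
                exact mul_le_mul_of_nonneg_left (Finset.sum_le_sum fun i _ =>
                  mul_le_mul_of_nonneg_left (abs_coordProj_le _ y i) (hc i)) zero_le_two
      _ = 2 ^ Fintype.card ι * (M ^ 2 * Real.exp (2 * ∑ i, c i * |y i|)) := by
          rw [Finset.sum_const, Finset.card_powerset, Finset.card_univ, nsmul_eq_mul]
          norm_num
  have hmeas : ∀ τ, Measurable fun y => ‖D τ y‖ₑ ^ 2 := fun τ => by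
    have := (hD τ).enorm.measurable
    fun_prop
  have hN : ∑ τ ∈ S, ∫⁻ z : {i // τ i = α} → ℝ, ‖D τ (glue (fun i => τ i = α) z 0)‖ₑ ^ 2
        ∂(gaussian {i // τ i = α})
      ≤ ENNReal.ofReal ((M * 2 ^ ((Fintype.card ι : ℝ) / 2) *
          Real.exp (∑ i, (c i ^ 2 + 2 * c i / Real.sqrt (2 * Real.pi)))) ^ 2) := by
    calc _ = ∑ τ ∈ S, ∫⁻ y, ‖D τ (coordProj (fun i => τ i = α) y)‖ₑ ^ 2 ∂(gaussian ι) :=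
          Finset.sum_congr rfl fun τ _ =>
            lintegral_gaussian_subtype (fun i => τ i = α) (hmeas τ)
      _ = ∫⁻ y, ∑ τ ∈ S, ‖D τ (coordProj (fun i => τ i = α) y)‖ₑ ^ 2 ∂(gaussian ι) :=
          (lintegral_finsetSum _ fun τ _ =>
            (hmeas τ).comp (continuous_coordProj _).measurable).symm
      _ ≤ ∫⁻ y, 2 ^ Fintype.card ι *
            ENNReal.ofReal (M ^ 2 * Real.exp (2 * ∑ i, c i * |y i|)) ∂(gaussian ι) :=
          lintegral_mono hpt
      _ ≤ 2 ^ Fintype.card ι * ENNReal.ofReal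
          ((M * Real.exp (∑ i, (c i ^ 2 + 2 * c i / Real.sqrt (2 * Real.pi)))) ^ 2) := by
          rw [lintegral_const_mul' _ _ (by finiteness)]
          gcongr
          exact lintegral_ofReal_sq_exp_le hc M
      _ = _ := by
          have h2 : (2 : ℝ≥0∞) ^ Fintype.card ι = ENNReal.ofReal (2 ^ Fintype.card ι) := by
            rw [ENNReal.ofReal_pow zero_le_two, ENNReal.ofReal_ofNat]
          have h3 : ((2 : ℝ) ^ ((Fintype.card ι : ℝ) / 2)) ^ 2 = 2 ^ Fintype.card ι := by
            rw [← Real.rpow_natCast, ← Real.rpow_mul zero_le_two, ← Real.rpow_natCast]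
            congr 1
            push_cast
            ring
          rw [h2, ← ENNReal.ofReal_mul (by positivity)]
          congr 1
          rw [mul_pow, mul_pow, mul_pow, h3]
          ring
  unfold normOfFamily
  refine (ENNReal.rpow_le_rpow hN (by norm_num)).trans (le_of_eq ?_)
  rw [ENNReal.ofReal_rpow_of_nonneg (by positivity) (by norm_num), ← Real.sqrt_eq_rpow,
    Real.sqrt_sq (by positivity)]

end Anchored

/-! ### The lognormal diffusion problem -/

section Diffusion

variable {d : ℕ} {Ω : Opens (EuclideanSpace ℝ (Fin d))}
  {φ : ℕ → EuclideanSpace ℝ (Fin d) → ℝ} {b : ℕ → ℝ}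

theorem ae_sum_abs_div_le_kappa (hb : ∀ j, 0 < b j) (hκ : kappa Ω φ b ≠ ⊤) (v : Finset ℕ) :
    ∀ᵐ x ∂(volume.restrict (Ω : Set (EuclideanSpace ℝ (Fin d)))),
      ∑ i : v, |φ i x| / b i ≤ (kappa Ω φ b).toReal := by
  filter_upwards [ENNReal.ae_le_essSup fun x => ∑' j, ENNReal.ofReal (|φ j x| / b j)] with x hx
  rw [Finset.sum_coe_sort v fun j => |φ j x| / b j, ← ENNReal.ofReal_le_iff_le_toReal hκ,
    ENNReal.ofReal_sum_of_nonneg fun j _ => div_nonneg (abs_nonneg _) (hb j).le]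
  exact (ENNReal.sum_le_tsum v).trans hx

theorem weight_subtype_eq_coeff (v : Finset ℕ) (y : ℕ → ℝ) :
    weight (fun i : v => φ i) (fun i => y i) = coeff φ v y := by
  funext x
  unfold weight coeff
  rw [Finset.sum_coe_sort v fun j => y j * φ j x]

/-- Truncating to v amounts to setting the other parameters to zero, so every term of the anchored
sum is a value of a single parametric solution. -/
theorem coeff_glue_eq {𝔲 v : Finset ℕ} (hv : v ⊆ 𝔲) (y : 𝔲 → ℝ) :
    coeff φ v (glue (fun j => j ∈ 𝔲) y 0)
      = weight (fun i : 𝔲 => φ i) (coordProj (fun i : 𝔲 => (i : ℕ) ∈ v) y) := by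
  funext x
  unfold weight coeff
  congr 1
  have h1 : ∀ i : 𝔲, coordProj (fun i : 𝔲 => (i : ℕ) ∈ v) y i * φ i x
      = (fun j => if j ∈ v then glue (fun j => j ∈ 𝔲) y 0 j * φ j x else 0) i := fun i => by
    simp only [coordProj, glue, i.2, dif_pos]
    split_ifs <;> simp
  rw [Finset.sum_congr rfl fun i _ => h1 i, Finset.sum_coe_sort 𝔲
    fun j => if j ∈ v then glue (fun j => j ∈ 𝔲) y 0 j * φ j x else 0,
    Finset.sum_ite_mem, Finset.inter_eq_right.mpr hv]

theorem summable_of_memℓp {p : ℝ≥0∞} (hp1 : p ≤ 1) (hb : ∀ j, 0 < b j) (hbp : Memℓp b p) :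
    Summable b := by
  have h1 := hbp.of_exponent_ge hp1
  rw [memℓp_gen_iff (by simp)] at h1
  simpa [abs_of_pos (hb _)] using h1

variable [NeZero d] [Fact (Bornology.IsBounded (Ω : Set (EuclideanSpace ℝ (Fin d))))]

/-- The weak gradient as an isometric embedding of a subspace of `H¹₀(Ω)` into `L²(Ω; ℝᵈ)`. -/
def gradIsometry (W : Submodule ℝ (H10 Ω)) : W →ₗᵢ[ℝ] L2Vec Ω where
  toLinearMap := (grad Ω).comp W.subtype
  norm_map' v := (norm_H10 Ω v).symm

variable {W : Submodule ℝ (H10 Ω)} {f : StrongDual ℝ (H10 Ω)}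

theorem isSolution_coe_iff {a : EuclideanSpace ℝ (Fin d) → ℝ} (u : W) :
    IsSolution Ω W a f u ↔ ∀ w : W,
      ∫ x, a x * ⟪gradIsometry W u x, gradIsometry W w x⟫
        ∂(volume.restrict (Ω : Set (EuclideanSpace ℝ (Fin d)))) = f.comp W.subtypeL w :=
  ⟨fun h w => h.2 w w.2, fun h => ⟨u.2, fun w hw => h ⟨w, hw⟩⟩⟩

theorem isSolution_solution {a : EuclideanSpace ℝ (Fin d) → ℝ}
    (h : ∃ u, IsSolution Ω W a f u) : IsSolution Ω W a f (solution Ω W a f) := by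
  unfold solution
  rw [dif_pos h]
  exact h.choose_spec

variable [CompleteSpace W]

theorem existsUnique_isSolution
    (hφ : ∀ j, AEMeasurable (φ j) (volume.restrict (Ω : Set (EuclideanSpace ℝ (Fin d)))))
    (hb : ∀ j, 0 < b j) (hκ : kappa Ω φ b ≠ ⊤) (f : StrongDual ℝ (H10 Ω)) (v : Finset ℕ)
    (y : v → ℝ) : ∃! u, IsSolution Ω W (weight (fun i : v => φ i) y) f u := by
  obtain ⟨u, hu, huniq⟩ := existsUnique_weighted (fun i : v => hφ i) (fun i : v => hb i)
    ENNReal.toReal_nonneg (ae_sum_abs_div_le_kappa hb hκ v) (gradIsometry W)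
    (f.comp W.subtypeL) y
  refine ⟨u, (isSolution_coe_iff u).mpr hu, fun u' hu' => ?_⟩
  have h1 := huniq ⟨u', hu'.1⟩ ((isSolution_coe_iff ⟨u', hu'.1⟩).mp hu')
  exact congrArg Subtype.val h1

/-- If y i = 0, the subsets v and v ∪ {i} give the same coefficient with opposite signs, so they
cancel in pairs. -/
theorem anchoredTerm_eq_zero (𝔲 : Finset ℕ) (y : 𝔲 → ℝ) (hy : ∃ i, y i = 0) :
    anchoredTerm Ω W φ f 𝔲 y = 0 := by
  obtain ⟨i, hi⟩ := hy
  have hins : insert (i : ℕ) (𝔲.erase i) = 𝔲 := Finset.insert_erase i.2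
  have hnot : (i : ℕ) ∉ 𝔲.erase i := Finset.notMem_erase _ _
  unfold anchoredTerm
  conv_lhs => rw [show 𝔲.powerset = (insert (i : ℕ) (𝔲.erase i)).powerset by rw [hins]]
  rw [Finset.sum_powerset_insert hnot, ← Finset.sum_add_distrib]
  refine Finset.sum_eq_zero fun v hv => ?_
  have hv' := Finset.mem_powerset.mp hv
  have hiv : (i : ℕ) ∉ v := fun h => hnot (hv' h)
  have hcoeff : coeff φ (insert (i : ℕ) v) (glue (fun j => j ∈ 𝔲) y 0)
      = coeff φ v (glue (fun j => j ∈ 𝔲) y 0) := by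
    funext x
    unfold coeff
    rw [Finset.sum_insert hiv]
    simp [glue, hi]
  have hcard : 𝔲.card - v.card = 𝔲.card - (insert (i : ℕ) v).card + 1 := by
    have h1 := Finset.card_le_card hv'
    have h2 := Finset.card_erase_add_one i.2
    rw [Finset.card_insert_of_notMem hiv]
    omega
  rw [hcoeff, hcard, pow_succ, ← add_smul]
  simp

/-- The operator S treats both claims at once: the identity gives u_𝔲 and the functional G gives
G(u_𝔲). -/
theorem anchoredTerm_bounds
    (hφ : ∀ j, AEMeasurable (φ j) (volume.restrict (Ω : Set (EuclideanSpace ℝ (Fin d)))))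
    (hb : ∀ j, 0 < b j ∧ b j ≤ 1) (hsum : Summable b) {α : ℕ}
    (hα : 1 ≤ α) (hκ : kappa Ω φ b < ENNReal.ofReal (Real.log 2 / α))
    (f : StrongDual ℝ (H10 Ω)) (𝔲 : Finset ℕ)
    {E : Type*} [NormedAddCommGroup E] [NormedSpace ℝ E] [CompleteSpace E]
    (S : H10 Ω →L[ℝ] E) {s : ℝ} (hs : ‖S‖ ≤ s) :
    MemAnchored α (fun y => S (anchoredTerm Ω W φ f 𝔲 y)) ∧
      ∀ δ : ℝ, 0 < δ → δ < 1 → (kappa Ω φ b).toReal < δ * Real.log 2 / α →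
        anchoredNorm α (fun y => S (anchoredTerm Ω W φ f 𝔲 y)) ≤
          ENNReal.ofReal ((∏ j ∈ 𝔲, b j) * 2 ^ ((𝔲.card : ℝ) / 2) *
            constC' (kappa Ω φ b).toReal δ b * s * ‖f‖) := by
  have hb0 : ∀ j, 0 < b j := fun j => (hb j).1
  have hκ' : kappa Ω φ b ≠ ⊤ := hκ.ne_top
  have hs0 : 0 ≤ s := (norm_nonneg S).trans hs
  have hα0 : (0 : ℝ) < α := by exact_mod_cast hα
  have hκlt : (kappa Ω φ b).toReal < Real.log 2 / α :=
    ENNReal.toReal_lt_of_lt_ofReal hκ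
  set κ := (kappa Ω φ b).toReal with hκdef
  have hκ0 : 0 ≤ κ := ENNReal.toReal_nonneg
  have hae := ae_sum_abs_div_le_kappa hb0 hκ' 𝔲
  set U : (𝔲 → ℝ) → W := fun y =>
    ⟨solution Ω W (weight (fun i : 𝔲 => φ i) y) f,
      (isSolution_solution (existsUnique_isSolution hφ hb0 hκ' f 𝔲 y).exists).1⟩ with hUdef
  have hU : ∀ y w, ∫ x, weight (fun i : 𝔲 => φ i) y x *
      ⟪gradIsometry W (U y) x, gradIsometry W w x⟫
        ∂(volume.restrict (Ω : Set (EuclideanSpace ℝ (Fin d)))) = f.comp W.subtypeL w := fun y =>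
    (isSolution_coe_iff (U y)).mp
      (isSolution_solution (existsUnique_isSolution hφ hb0 hκ' f 𝔲 y).exists)
  obtain ⟨D, hD, hDbound⟩ := exists_family_weighted (fun i : 𝔲 => hφ i) (fun i : 𝔲 => hb i) hκ0 hae
    (gradIsometry W) hU
  have hF : ‖f.comp W.subtypeL‖ ≤ ‖f‖ := by
    refine ContinuousLinearMap.opNorm_le_bound _ (norm_nonneg f) fun w => ?_
    exact f.le_opNorm w
  set S' : W →L[ℝ] E := S.comp W.subtypeL with hS'
  have hS'norm : ∀ w, ‖S' w‖ ≤ s * ‖w‖ := fun w => S.le_of_opNorm_le hs w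
  set c : 𝔲 → ℝ := fun i => κ * b i with hc
  have hc0 : ∀ i, 0 ≤ c i := fun i => mul_nonneg hκ0 (hb0 i).le
  have hanch : (fun y => S (anchoredTerm Ω W φ f 𝔲 y)) = fun y => ∑ v ∈ 𝔲.powerset,
      (-1 : ℝ) ^ (𝔲.card - v.card) • S' (U (coordProj (fun i : 𝔲 => (i : ℕ) ∈ v) y)) := by
    funext y
    unfold anchoredTerm
    rw [map_sum]
    refine Finset.sum_congr rfl fun v hv => ?_
    rw [map_smul, coeff_glue_eq (Finset.mem_powerset.mp hv)]
    rfl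
  have hfam := IsSmoothFamily.sum_smul 𝔲.powerset (fun v => (-1 : ℝ) ^ (𝔲.card - v.card))
    (fun v _ => (hD.clm_comp S').comp_coordProj (fun i : 𝔲 => (i : ℕ) ∈ v))
  rw [← hanch] at hfam
  set D' : (𝔲 → ℕ) → (𝔲 → ℝ) → E := fun τ y => ∑ v ∈ 𝔲.powerset,
    (-1 : ℝ) ^ (𝔲.card - v.card) • if ∀ i : 𝔲, τ i ≠ 0 → (i : ℕ) ∈ v
      then S' (D τ (coordProj (fun i : 𝔲 => (i : ℕ) ∈ v) y)) else 0 with hD'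
  -- When every τ i ≥ 1, a term with v ≠ 𝔲 is differentiated in a frozen direction and drops out; v
  -- = 𝔲 has sign +1.
  have hD'eq : ∀ τ ∈ Fintype.piFinset fun _ : 𝔲 => Finset.Icc 1 α, ∀ y,
      D' τ y = S' (D τ y) := by
    intro τ hτ y
    have hτ0 : ∀ i, τ i ≠ 0 := fun i =>
      Nat.one_le_iff_ne_zero.mp (Finset.mem_Icc.mp (Fintype.mem_piFinset.mp hτ i)).1
    simp only [hD']
    rw [Finset.sum_eq_single 𝔲]
    · have h1 : coordProj (fun i : 𝔲 => (i : ℕ) ∈ 𝔲) y = y := by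
        funext i
        simp [coordProj]
      rw [if_pos (fun i _ => i.2), h1]
      simp
    · intro v hv hne
      rw [if_neg, smul_zero]
      intro h
      exact hne (Finset.Subset.antisymm (Finset.mem_powerset.mp hv)
        fun j hj => h ⟨j, hj⟩ (hτ0 _))
    · simp
  have hnorm : ∀ δ : ℝ, 0 ≤ δ → δ < 1 → α * κ ≤ δ * Real.log 2 →
      normOfFamily α D' ≤ ENNReal.ofReal ((∏ j ∈ 𝔲, b j) * 2 ^ ((𝔲.card : ℝ) / 2) *
            constC' κ δ b * s * ‖f‖) := by
    intro δ h0 h1 hδ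
    have hδ' : 0 < 1 - δ := by linarith
    have hbp : 0 ≤ ∏ j ∈ 𝔲, b j := Finset.prod_nonneg fun j _ => (hb0 j).le
    have hn := normOfFamily_le (α := α) (D := D') hfam.continuous hc0
      (M := (∏ j ∈ 𝔲, b j) * Real.sqrt (1 - δ)⁻¹ * s * ‖f‖) (by positivity) (fun y => by
        have h2 := hDbound α δ h0 h1 hδ y
        rw [Finset.prod_coe_sort 𝔲 b] at h2
        calc ∑ τ ∈ Fintype.piFinset fun _ : 𝔲 => Finset.Icc 1 α, ‖D' τ y‖ ^ 2
            ≤ ∑ τ ∈ Fintype.piFinset fun _ : 𝔲 => Finset.Icc 1 α, s ^ 2 * ‖D τ y‖ ^ 2 := by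
              refine Finset.sum_le_sum fun τ hτ => ?_
              rw [hD'eq τ hτ, ← mul_pow]
              exact pow_le_pow_left₀ (norm_nonneg _) (hS'norm _) 2
          _ ≤ s ^ 2 * ((∏ j ∈ 𝔲, b j) ^ 2 * (1 - δ)⁻¹ * ‖f‖ ^ 2 *
                Real.exp (2 * ∑ i, c i * |y i|)) := by
              rw [← Finset.mul_sum]
              refine mul_le_mul_of_nonneg_left (h2.trans ?_) (sq_nonneg s)
              gcongr
          _ = _ := by
              rw [mul_pow, mul_pow, mul_pow, Real.sq_sqrt (by positivity)]
              ring)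
    refine hn.trans (ENNReal.ofReal_le_ofReal ?_)
    have hsb : Summable fun j => (κ * b j) ^ 2 + 2 * κ * b j / Real.sqrt (2 * Real.pi) := by
      have h3 : Summable fun j => b j ^ 2 := Summable.of_nonneg_of_le (fun j => sq_nonneg _)
        (fun j => by nlinarith [hb j]) hsum
      refine (((h3.mul_left (κ ^ 2)).congr fun j => by ring).add
        ((hsum.mul_left (2 * κ / Real.sqrt (2 * Real.pi))).congr fun j => ?_))
      ring
    have hexp : ∑ i : 𝔲, (c i ^ 2 + 2 * c i / Real.sqrt (2 * Real.pi))
        ≤ ∑' j, ((κ * b j) ^ 2 + 2 * κ * b j / Real.sqrt (2 * Real.pi)) := by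
      refine le_trans (le_of_eq ?_) (hsb.sum_le_tsum 𝔲 fun j _ => by
        have := (hb0 j).le
        positivity)
      rw [← Finset.sum_coe_sort 𝔲]
      refine Finset.sum_congr rfl fun i _ => ?_
      simp only [hc, mul_assoc]
    unfold constC'
    rw [tsum_geometric_of_lt_one h0 h1, Fintype.card_coe]
    calc _ ≤ (∏ j ∈ 𝔲, b j) * Real.sqrt (1 - δ)⁻¹ * s * ‖f‖ * 2 ^ ((𝔲.card : ℝ) / 2) *
          Real.exp (∑' j, ((κ * b j) ^ 2 + 2 * κ * b j / Real.sqrt (2 * Real.pi))) := by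
          gcongr
      _ = _ := by ring
  have hmixed := hfam.isMixedDerivFamily α
  have hlog : 0 < Real.log 2 := Real.log_pos one_lt_two
  refine ⟨⟨fun y hy => ?_, ?_, D', hmixed, ?_⟩, fun δ h0 h1 hδ => ?_⟩
  · rw [anchoredTerm_eq_zero 𝔲 y hy, map_zero]
  · have hcont := hfam.continuous 0
    rw [hfam.zero] at hcont
    refine integrable_of_norm_le_exp hcont hc0
      (M := ∑ _v ∈ 𝔲.powerset, s * ‖f‖) (by positivity) fun y => ?_
    rw [congrFun hanch y, Finset.sum_mul]
    refine norm_sum_le_of_le _ fun v _ => ?_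
    rw [norm_smul, norm_pow, norm_neg, norm_one, one_pow, one_mul, mul_assoc]
    refine (hS'norm _).trans (mul_le_mul_of_nonneg_left ?_ hs0)
    refine (weighted_energy_le (fun i : 𝔲 => hφ i) (fun i : 𝔲 => hb0 i) hκ0 hae (gradIsometry W)
      (hU _)).1.trans ?_
    exact mul_le_mul hF (exp_sum_coordProj_le _ hc0 y) (Real.exp_pos _).le (norm_nonneg f)
  · rw [lt_div_iff₀ hα0] at hκlt
    -- Membership comes with no δ, so the smallest admissible one is taken. It is 0 when κ = 0,
    -- which is why `hnorm` allows δ = 0.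
    refine lt_of_le_of_lt (hnorm (α * κ / Real.log 2) (by positivity) ?_ ?_)
      ENNReal.ofReal_lt_top
    · rw [div_lt_one hlog]
      linarith
    · rw [div_mul_cancel₀ _ hlog.ne']
  · refine (iInf₂_le D' hmixed).trans (hnorm δ h0.le h1 ?_)
    rw [lt_div_iff₀ hα0] at hδ
    linarith

theorem anchored_main
    (hφ : ∀ j, AEMeasurable (φ j) (volume.restrict (Ω : Set (EuclideanSpace ℝ (Fin d)))))
    (hb : ∀ j, 0 < b j ∧ b j ≤ 1) (hsum : Summable b) {α : ℕ}
    (hα : 1 ≤ α) (hκ : kappa Ω φ b < ENNReal.ofReal (Real.log 2 / α))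
    (f G : StrongDual ℝ (H10 Ω)) (𝔲 : Finset ℕ) :
    (∀ (v : Finset ℕ) (y : ℕ → ℝ), ∃! w, IsSolution Ω W (coeff φ v y) f w) ∧
      MemAnchored α (anchoredTerm Ω W φ f 𝔲) ∧
      MemAnchored α (fun y => G (anchoredTerm Ω W φ f 𝔲 y)) ∧
      ∀ δ : ℝ, 0 < δ → δ < 1 → (kappa Ω φ b).toReal < δ * Real.log 2 / α →
        anchoredNorm α (anchoredTerm Ω W φ f 𝔲) ≤
          ENNReal.ofReal ((∏ j ∈ 𝔲, b j) * 2 ^ ((𝔲.card : ℝ) / 2) *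
            constC' (kappa Ω φ b).toReal δ b * ‖f‖) ∧
        anchoredNorm α (fun y => G (anchoredTerm Ω W φ f 𝔲 y)) ≤
          ENNReal.ofReal ((∏ j ∈ 𝔲, b j) * 2 ^ ((𝔲.card : ℝ) / 2) *
            constC' (kappa Ω φ b).toReal δ b * ‖G‖ * ‖f‖) := by
  have h1 := anchoredTerm_bounds (W := W) hφ hb hsum hα hκ f 𝔲
    (ContinuousLinearMap.id ℝ (H10 Ω)) ContinuousLinearMap.norm_id_le
  have h2 := anchoredTerm_bounds (W := W) hφ hb hsum hα hκ f 𝔲 G le_rfl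
  simp only [ContinuousLinearMap.id_apply, mul_one] at h1
  refine ⟨fun v y => ?_, h1.1, h2.1, fun δ h0 h1' hδ => ⟨h1.2 δ h0 h1' hδ, h2.2 δ h0 h1' hδ⟩⟩
  rw [← weight_subtype_eq_coeff]
  exact existsUnique_isSolution hφ (fun j => (hb j).1) hκ.ne_top f v _

end Diffusion

end LognormalPDE

end

/-! ### The main theorem, for `V` and for its finite-dimensional subspaces -/

theorem mainTheorem7 {d : ℕ} [NeZero d] (Ω : TopologicalSpace.Opens (EuclideanSpace ℝ (Fin d)))
    [Fact (Bornology.IsBounded (Ω : Set (EuclideanSpace ℝ (Fin d))))]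
    (φ : ℕ → EuclideanSpace ℝ (Fin d) → ℝ)
    (hφ : ∀ j, AEMeasurable (φ j)
      (MeasureTheory.volume.restrict (Ω : Set (EuclideanSpace ℝ (Fin d)))))
    (b : ℕ → ℝ) (hb : ∀ j, 0 < b j ∧ b j ≤ 1)
    (α : ℕ) (hα : 1 ≤ α)
    (hκ : LognormalPDE.kappa Ω φ b < ENNReal.ofReal (Real.log 2 / α))
    (p : ℝ≥0∞) (hp0 : 0 < p) (hp1 : p ≤ 1) (hbp : Memℓp b p)
    (f G : StrongDual ℝ (LognormalPDE.H10 Ω)) (𝔲 : Finset ℕ) :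
    -- the exact solution
    ((∀ (v : Finset ℕ) (y : ℕ → ℝ),
        ∃! w, LognormalPDE.IsSolution Ω ⊤ (LognormalPDE.coeff φ v y) f w) ∧
      LognormalPDE.MemAnchored α (LognormalPDE.anchoredTerm Ω ⊤ φ f 𝔲) ∧
      LognormalPDE.MemAnchored α (fun y => G (LognormalPDE.anchoredTerm Ω ⊤ φ f 𝔲 y)) ∧
      ∀ δ : ℝ, 0 < δ → δ < 1 →
        (LognormalPDE.kappa Ω φ b).toReal < δ * Real.log 2 / α →
        LognormalPDE.anchoredNorm α (LognormalPDE.anchoredTerm Ω ⊤ φ f 𝔲) ≤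
          ENNReal.ofReal ((∏ j ∈ 𝔲, b j) * 2 ^ ((𝔲.card : ℝ) / 2) *
            LognormalPDE.constC' (LognormalPDE.kappa Ω φ b).toReal δ b * ‖f‖) ∧
        LognormalPDE.anchoredNorm α (fun y => G (LognormalPDE.anchoredTerm Ω ⊤ φ f 𝔲 y)) ≤
          ENNReal.ofReal ((∏ j ∈ 𝔲, b j) * 2 ^ ((𝔲.card : ℝ) / 2) *
            LognormalPDE.constC' (LognormalPDE.kappa Ω φ b).toReal δ b * ‖G‖ * ‖f‖)) ∧
    -- the finite element approximations
    ∀ W : Submodule ℝ (LognormalPDE.H10 Ω), FiniteDimensional ℝ W →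
      (∀ (v : Finset ℕ) (y : ℕ → ℝ),
        ∃! w, LognormalPDE.IsSolution Ω W (LognormalPDE.coeff φ v y) f w) ∧
      LognormalPDE.MemAnchored α (LognormalPDE.anchoredTerm Ω W φ f 𝔲) ∧
      LognormalPDE.MemAnchored α (fun y => G (LognormalPDE.anchoredTerm Ω W φ f 𝔲 y)) ∧
      ∀ δ : ℝ, 0 < δ → δ < 1 →
        (LognormalPDE.kappa Ω φ b).toReal < δ * Real.log 2 / α →
        LognormalPDE.anchoredNorm α (LognormalPDE.anchoredTerm Ω W φ f 𝔲) ≤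
          ENNReal.ofReal ((∏ j ∈ 𝔲, b j) * 2 ^ ((𝔲.card : ℝ) / 2) *
            LognormalPDE.constC' (LognormalPDE.kappa Ω φ b).toReal δ b * ‖f‖) ∧
        LognormalPDE.anchoredNorm α (fun y => G (LognormalPDE.anchoredTerm Ω W φ f 𝔲 y)) ≤
          ENNReal.ofReal ((∏ j ∈ 𝔲, b j) * 2 ^ ((𝔲.card : ℝ) / 2) *
            LognormalPDE.constC' (LognormalPDE.kappa Ω φ b).toReal δ b * ‖G‖ * ‖f‖) := by
  -- Since p ≤ 1, ℓ^p is contained in ℓ¹, which makes the series in C' converge.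
  have hsum := LognormalPDE.summable_of_memℓp hp1 (fun j => (hb j).1) hbp
  refine ⟨?_, fun W hW => ?_⟩
  · have : CompleteSpace (⊤ : Submodule ℝ (LognormalPDE.H10 Ω)) :=
      (isClosed_univ (X := LognormalPDE.H10 Ω)).completeSpace_coe
    exact LognormalPDE.anchored_main hφ hb hsum hα hκ f G 𝔲
  · have : CompleteSpace W := FiniteDimensional.complete ℝ W
    exact LognormalPDE.anchored_main hφ hb hsum hα hκ f G 𝔲
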